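/- Conventions. A model category is a category with all small limits and colimits equipped with classes of weak equivalences, fibrations and cofibrations satisfying Quillen's (closed) model category axioms, with functorial factorizations. A left Quillen functor is a left adjoint that preserves cofibrations and trivial cofibrations. A small category $\mathbf{D}$ is direct if there are an ordinal $\lambda$ and a functor $d:\mathbf{D}\to\lambda$ with $d(s)<d(t)$ for every non-identity morphism $s\to t$; it is inverse if $\mathbf{D}^{op}$ is direct. Let $\mathbf{D}$ be a small category and let $\mathcal{M}$ be a diagram of model categories indexed on $\mathbf{D}$: a functor (or, more generally, a pseudofunctor) from $\mathbf{D}$ to categories, assigning to each object $s$ a model category $\mathcal{M}(s)$ and to each morphism $a:s\to t$ a left Quillen functor $a_*:\mathcal{M}(s)\to\mathcal{M}(t)$, with right adjoint $a^*$. An $\mathcal{M}$-diagram $X$ consists of objects $X(s)\in\mathcal{M}(s)$ for $s\in\mathbf{D}$ and morphisms $\widetilde X(a):a_*X(s)\to X(t)$ for $a:s\to t$ in $\mathbf{D}$, compatible with identities and composition. A morphism $X\to Y$ of $\mathcal{M}$-diagrams is a family of morphisms $X(s)\to Y(s)$ compatible with the structure maps. For $t\in\mathbf{D}$ let $\mathbf{D}_t$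 be the category of all non-identity morphisms of $\mathbf{D}$ with codomain $t$ (and commutative triangles), and let $L_tX=\operatorname{colim}_{(a:s\to t)\in\mathbf{D}_t}a_*X(s)$ be the latching object, formed in $\mathcal{M}(t)$, with its canonical map $L_tX\to X(t)$. For $s\in\mathbf{D}$ let $\mathbf{D}^s$ be the category of all non-identity morphisms of $\mathbf{D}$ with domain $s$, and let $M_sX=\lim_{(a:s\to t)\in\mathbf{D}^s}a^*X(t)$ be the matching object, formed in $\mathcal{M}(s)$, with its canonical map $X(s)\to M_sX$. Theorem 3.1. (i) If $\mathbf{D}$ is direct, then the category of $\mathcal{M}$-diagrams is a model category (complete, cocomplete, with functorial factorizations) in which a morphism $X\to Y$ is a weak equivalence (respectively a fibration) if and only if $X(s)\to Y(s)$ is a weak equivalence (respectively a fibration) in $\mathcal{M}(s)$ for all $s$; and $X\to Y$ is a cofibration (respectively a trivial cofibration) if and only if the induced map $X(s)\amalg_{L_sX}L_sY\to Y(s)$ is a cofibration (respectively a trivial cofibration) in $\mathcal{M}(s)$ for all $s$. (ii) If $\mathbf{D}$ is inverse, then the category of $\mathcal{M}$-diagrams is a model category (complete, cocomplete, with functorial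 factorizations) in which a morphism $X\to Y$ is a weak equivalence (respectively a cofibration) if and only if $X(s)\to Y(s)$ is a weak equivalence (respectively a cofibration) in $\mathcal{M}(s)$ for all $s$; and $X\to Y$ is a fibration (respectively a trivial fibration) if and only if the induced map $X(s)\to Y(s)\times_{M_sY}M_sX$ is a fibration (respectively a trivial fibration) in $\mathcal{M}(s)$ for all $s$. -/

import Mathlib

open CategoryTheory Limits HomotopicalAlgebra

universe w v u

noncomputable section

namespace ModelDiagram

/-! ## Direct and inverse categories -/

section Shapes

variable {D : Type w} [SmallCategory D]

/-- The morphism `a` is not an identity morphism. -/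
def NonId {s t : D} (a : s ⟶ t) : Prop := ¬ MorphismProperty.identities D a

variable (D)

/-- A small category is direct if it admits a linear extension: a functor to an ordinal
(regarded as a poset, hence as a category) sending every non-identity morphism to a
non-identity morphism, that is, strictly raising the degree along it. -/
def IsDirect : Prop :=
  ∃ (l : Ordinal.{w}) (d : D ⥤ Set.Iio l),
    ∀ ⦃s t : D⦄ (a : s ⟶ t), NonId a → d.obj s < d.obj t

/-- A small category is inverse if its opposite category is direct. -/
def IsInverse : Prop := IsDirect Dᵒᵖ

variable {D}

/-- The category of all non-identity morphisms with codomain `t`; its morphisms are the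
commutative triangles over `t`. -/
abbrev LatchingCat (t : D) : Type w :=
  ObjectProperty.FullSubcategory (fun a : Over t ↦ NonId a.hom)

/-- The category of all non-identity morphisms with domain `s`; its morphisms are the
commutative triangles under `s`. -/
abbrev MatchingCat (s : D) : Type w :=
  ObjectProperty.FullSubcategory (fun a : Under s ↦ NonId a.hom)

end Shapes

/-! ## Model categories and left Quillen functors -/

/-- On top of the axioms CM1-CM5 in `ModelCategory`, a model category is required here to have
all small limits and colimits and *functorial* factorizations. -/
class IsBicompleteFunctorial (C : Type u) [Category.{v} C] [ModelCategory C] : Prop where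
  hasLimits : HasLimitsOfSize.{w, w} C
  hasColimits : HasColimitsOfSize.{w, w} C
  functorial_cof_trivFib :
    MorphismProperty.HasFunctorialFactorization (cofibrations C) (trivialFibrations C)
  functorial_trivCof_fib :
    MorphismProperty.HasFunctorialFactorization (trivialCofibrations C) (fibrations C)

attribute [instance] IsBicompleteFunctorial.hasLimits IsBicompleteFunctorial.hasColimits

/-- A left Quillen functor: a left adjoint preserving cofibrations and trivial cofibrations. -/
class IsLeftQuillen {C D : Type*} [Category* C] [Category* D]
    [ModelCategory C] [ModelCategory D] (F : C ⥤ D) : Prop where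
  isLeftAdjoint : F.IsLeftAdjoint
  cofibration_map : ∀ ⦃X Y : C⦄ (f : X ⟶ Y), Cofibration f → Cofibration (F.map f)
  trivialCofibration_map : ∀ ⦃X Y : C⦄ (f : X ⟶ Y), Cofibration f → WeakEquivalence f →
    Cofibration (F.map f) ∧ WeakEquivalence (F.map f)

attribute [instance] IsLeftQuillen.isLeftAdjoint

/-! ## Diagrams of categories -/

section Diagrams

variable {D : Type w} [SmallCategory D] (M : Pseudofunctor (LocallyDiscrete D) Cat.{v, u})

/-- The category `M(s)` assigned to `s`. -/
abbrev Fiber (s : D) : Type u := M.obj ⟨s⟩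

/-- The functor `a_* : M(s) ⥤ M(t)` assigned to `a : s ⟶ t`. -/
abbrev push {s t : D} (a : s ⟶ t) : Fiber M s ⥤ Fiber M t := (M.map a.toLoc).toFunctor

/-- The structural isomorphism `(𝟙 s)_* ≅ 𝟭`. -/
def pushId (s : D) : push M (𝟙 s) ≅ 𝟭 (Fiber M s) := Cat.Hom.toNatIso (M.mapId ⟨s⟩)

/-- The structural isomorphism `c_* ≅ b_* ∘ a_*` whenever `a ≫ b = c`. -/
def pushComp {r s t : D} (a : r ⟶ s) (b : s ⟶ t) (c : r ⟶ t) (h : a ≫ b = c) :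
    push M c ≅ push M a ⋙ push M b :=
  Cat.Hom.toNatIso (M.mapComp' a.toLoc b.toLoc c.toLoc (by subst h; rfl))

lemma pushComp_naturality {r s t : D} (a : r ⟶ s) (b : s ⟶ t) (c : r ⟶ t) (h : a ≫ b = c)
    {x y : Fiber M r} (f : x ⟶ y) :
    (push M c).map f ≫ (pushComp M a b c h).hom.app y =
      (pushComp M a b c h).hom.app x ≫ (push M b).map ((push M a).map f) :=
  (pushComp M a b c h).hom.naturality f

lemma pushComp_id {s t : D} (b : s ⟶ t) (h : 𝟙 s ≫ b = b) (x : Fiber M s) :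
    (pushComp M (𝟙 s) b b h).hom.app x ≫ (push M b).map ((pushId M s).hom.app x) = 𝟙 _ := by
  have e := M.mapComp'_id_comp_hom b.toLoc
  have e' := congrArg (fun α ↦ α.toNatTrans.app x) e
  simp at e'
  refine (congrArg (· ≫ (push M b).map ((pushId M s).hom.app x)) e').trans ?_
  exact ((push M b).map_comp _ _).symm.trans
    ((congrArg (push M b).map ((pushId M s).inv_hom_id_app x)).trans ((push M b).map_id _))

lemma pushComp_id' {s t : D} (a : s ⟶ t) (h : a ≫ 𝟙 t = a) (x : Fiber M s) :
    (pushComp M a (𝟙 t) a h).hom.app x ≫ (pushId M t).hom.app ((push M a).obj x) = 𝟙 _ := by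
  have e := M.mapComp'_comp_id_hom a.toLoc
  have e' := congrArg (fun α ↦ α.toNatTrans.app x) e
  simp at e'
  exact (congrArg (· ≫ (pushId M t).hom.app ((push M a).obj x)) e').trans
    ((pushId M t).inv_hom_id_app _)

lemma pushComp_assoc {q r s t : D} (a : q ⟶ r) (b : r ⟶ s) (c : s ⟶ t)
    (ab : q ⟶ s) (bc : r ⟶ t) (abc : q ⟶ t) (hab : a ≫ b = ab) (hbc : b ≫ c = bc)
    (h : ab ≫ c = abc) (h' : a ≫ bc = abc) (x : Fiber M q) :
    (pushComp M a bc abc h').hom.app x ≫ (pushComp M b c bc hbc).hom.app ((push M a).obj x) =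
      (pushComp M ab c abc h).hom.app x ≫ (push M c).map ((pushComp M a b ab hab).hom.app x) := by
  have e := M.mapComp'₀₁₃_hom_comp_whiskerLeft_mapComp'_hom a.toLoc b.toLoc c.toLoc
    ab.toLoc bc.toLoc abc.toLoc (by subst hab; rfl) (by subst hbc; rfl) (by subst h'; rfl)
  have e' := congrArg (fun α ↦ α.toNatTrans.app x) e
  simp at e'
  exact e'

/-- An `M`-diagram `X`: objects `X(s)` of `M(s)` together with a transitive system of morphisms
`a_* X(s) ⟶ X(t)` for `a : s ⟶ t`. -/
structure MDiagram where
  /-- the object `X(s)` of `M(s)` -/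
  obj (s : D) : Fiber M s
  /-- the structure morphism `a_* X(s) ⟶ X(t)` -/
  map {s t : D} (a : s ⟶ t) : (push M a).obj (obj s) ⟶ obj t
  map_id (s : D) : map (𝟙 s) = (pushId M s).hom.app (obj s)
  map_comp {r s t : D} (a : r ⟶ s) (b : s ⟶ t) :
    map (a ≫ b) = (pushComp M a b (a ≫ b) rfl).hom.app (obj r) ≫ (push M b).map (map a) ≫ map b

variable {M}

namespace MDiagram

lemma map_comp' (X : MDiagram M) {r s t : D} (a : r ⟶ s) (b : s ⟶ t) (c : r ⟶ t)
    (h : a ≫ b = c) :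
    (pushComp M a b c h).hom.app (X.obj r) ≫ (push M b).map (X.map a) ≫ X.map b = X.map c := by
  subst h
  exact (X.map_comp a b).symm

/-- A morphism of `M`-diagrams: morphisms `X(s) ⟶ Y(s)` compatible with the structure maps. -/
@[ext]
structure Hom (X Y : MDiagram M) where
  /-- the component `X(s) ⟶ Y(s)` -/
  app (s : D) : X.obj s ⟶ Y.obj s
  naturality {s t : D} (a : s ⟶ t) : (push M a).map (app s) ≫ Y.map a = X.map a ≫ app t

instance : Category (MDiagram M) where
  Hom := Hom
  id X :=
    { app := fun s ↦ 𝟙 (X.obj s)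
      naturality := fun a ↦ by simp }
  comp f g :=
    { app := fun s ↦ f.app s ≫ g.app s
      naturality := fun a ↦ by
        rw [Functor.map_comp, Category.assoc, g.naturality, ← Category.assoc, f.naturality,
          Category.assoc] }

@[simp] lemma id_app (X : MDiagram M) (s : D) : Hom.app (𝟙 X) s = 𝟙 (X.obj s) := rfl

@[simp] lemma comp_app {X Y Z : MDiagram M} (f : X ⟶ Y) (g : Y ⟶ Z) (s : D) :
    Hom.app (f ≫ g) s = Hom.app f s ≫ Hom.app g s := rfl

/-! ## Latching objects -/

section Latching

/-- For a triangle `g ≫ b = a`, the morphism `a_* X(r) ≅ b_* g_* X(r) ⟶ b_* X(s)`. -/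
def pushMap (X : MDiagram M) {r s t : D} (g : r ⟶ s) (b : s ⟶ t) (a : r ⟶ t) (h : g ≫ b = a) :
    (push M a).obj (X.obj r) ⟶ (push M b).obj (X.obj s) :=
  (pushComp M g b a h).hom.app (X.obj r) ≫ (push M b).map (X.map g)

lemma pushMap_id (X : MDiagram M) {s t : D} (a : s ⟶ t) (h : 𝟙 s ≫ a = a) :
    X.pushMap (𝟙 s) a a h = 𝟙 _ := by
  rw [pushMap, X.map_id]
  exact pushComp_id M _ _ _

lemma pushMap_comp (X : MDiagram M) {r₁ r₂ r₃ t : D} (g : r₁ ⟶ r₂) (g' : r₂ ⟶ r₃)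
    (k : r₁ ⟶ r₃) (hk : g ≫ g' = k) (a : r₁ ⟶ t) (b : r₂ ⟶ t) (c : r₃ ⟶ t)
    (h : g ≫ b = a) (h' : g' ≫ c = b) (h'' : k ≫ c = a) :
    X.pushMap k c a h'' = X.pushMap g b a h ≫ X.pushMap g' c b h' := by
  simp only [pushMap]
  rw [← X.map_comp' g g' k hk, Functor.map_comp, Functor.map_comp,
    ← reassoc_of% (pushComp_assoc M g g' c k b a hk h' h'' h), Category.assoc,
    reassoc_of% (pushComp_naturality M g' c b h' (X.map g))]

lemma pushMap_naturality {X Y : MDiagram M} (f : X ⟶ Y) {r s t : D} (g : r ⟶ s) (b : s ⟶ t)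
    (a : r ⟶ t) (h : g ≫ b = a) :
    X.pushMap g b a h ≫ (push M b).map (Hom.app f s) =
      (push M a).map (Hom.app f r) ≫ Y.pushMap g b a h := by
  rw [pushMap, pushMap, Category.assoc, ← Functor.map_comp, ← Hom.naturality f,
    Functor.map_comp, reassoc_of% (pushComp_naturality M g b a h (Hom.app f r))]

lemma pushMap_map (X : MDiagram M) {r s t : D} (g : r ⟶ s) (b : s ⟶ t)
    (a : r ⟶ t) (h : g ≫ b = a) : X.pushMap g b a h ≫ X.map b = X.map a := by
  rw [pushMap, Category.assoc, X.map_comp' g b a h]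

/-- The functor from the latching category of `t` to `M(t)` sending `a : s ⟶ t` to `a_* X(s)`. -/
def latchingDiagram (X : MDiagram M) (t : D) : LatchingCat t ⥤ Fiber M t where
  obj a := (push M a.obj.hom).obj (X.obj a.obj.left)
  map {a b} g := X.pushMap g.hom.left b.obj.hom a.obj.hom (Over.w g.hom)
  map_id _ := X.pushMap_id _ _
  map_comp _ _ := X.pushMap_comp _ _ _ rfl _ _ _ _ _ _

/-- The natural transformation `a_* X(s) ⟶ a_* Y(s)` induced by a morphism `X ⟶ Y`. -/
def latchingDiagramMap {X Y : MDiagram M} (f : X ⟶ Y) (t : D) :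
    X.latchingDiagram t ⟶ Y.latchingDiagram t where
  app a := (push M a.obj.hom).map (Hom.app f a.obj.left)
  naturality _ _ _ := pushMap_naturality f _ _ _ _

/-- The cocone `a_* X(s) ⟶ X(t)` given by the structure maps of `X`. -/
def latchingCocone (X : MDiagram M) (t : D) : Cocone (X.latchingDiagram t) where
  pt := X.obj t
  ι :=
    { app := fun a ↦ X.map a.obj.hom
      naturality := fun _ _ _ ↦ (X.pushMap_map _ _ _ _).trans (Category.comp_id _).symm }

variable [∀ s : D, HasColimitsOfSize.{w, w} (Fiber M s)]

/-- The latching object `L_t X`. -/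
abbrev latchingObj (X : MDiagram M) (t : D) : Fiber M t := colimit (X.latchingDiagram t)

/-- The induced morphism `L_t X ⟶ L_t Y`. -/
def latchingMap {X Y : MDiagram M} (f : X ⟶ Y) (t : D) : X.latchingObj t ⟶ Y.latchingObj t :=
  colimMap (latchingDiagramMap f t)

/-- The canonical morphism `L_t X ⟶ X(t)`. -/
def latchingTo (X : MDiagram M) (t : D) : X.latchingObj t ⟶ X.obj t :=
  colimit.desc (X.latchingDiagram t) (X.latchingCocone t)

lemma latchingTo_naturality {X Y : MDiagram M} (f : X ⟶ Y) (t : D) :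
    X.latchingTo t ≫ Hom.app f t = latchingMap f t ≫ Y.latchingTo t := by
  refine colimit.hom_ext fun a ↦ ?_
  refine ((colimit.ι_desc_assoc (X.latchingCocone t) a _).trans ?_).trans
    (ι_colimMap_assoc (latchingDiagramMap f t) a _).symm
  exact (Hom.naturality f a.obj.hom).symm.trans
    (congrArg ((push M a.obj.hom).map (Hom.app f a.obj.left) ≫ ·)
      (colimit.ι_desc (Y.latchingCocone t) a).symm)

variable [∀ s : D, HasPushouts (Fiber M s)]

/-- The induced morphism `X(t) ⨿_{L_t X} L_t Y ⟶ Y(t)`. -/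
def relLatchingMap {X Y : MDiagram M} (f : X ⟶ Y) (t : D) :
    pushout (X.latchingTo t) (latchingMap f t) ⟶ Y.obj t :=
  pushout.desc (Hom.app f t) (Y.latchingTo t) (latchingTo_naturality f t)

end Latching

/-! ## Matching objects -/

section Matching

variable [∀ (s t : D) (a : s ⟶ t), (push M a).IsLeftAdjoint]

variable (M) in
/-- The right adjoint `a^* : M(t) ⥤ M(s)` of `a_*`. -/
abbrev pull {s t : D} (a : s ⟶ t) : Fiber M t ⥤ Fiber M s := (push M a).rightAdjoint

variable (M) in
/-- The adjunction between `a_*` and `a^*`. -/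
abbrev adj {s t : D} (a : s ⟶ t) : push M a ⊣ pull M a := Adjunction.ofIsLeftAdjoint (push M a)

lemma map_homEquiv_counit {s t : D} (a : s ⟶ t) {x : Fiber M s} {y : Fiber M t}
    (φ : (push M a).obj x ⟶ y) :
    (push M a).map ((adj M a).homEquiv x y φ) ≫ (adj M a).counit.app y = φ :=
  ((adj M a).homEquiv_counit (g := (adj M a).homEquiv x y φ)).symm.trans
    (((adj M a).homEquiv x y).symm_apply_apply φ)

lemma pull_hom_ext {s t : D} (a : s ⟶ t) {x : Fiber M s} {y : Fiber M t}
    {f g : x ⟶ (pull M a).obj y}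
    (h : (push M a).map f ≫ (adj M a).counit.app y = (push M a).map g ≫ (adj M a).counit.app y) :
    f = g :=
  ((adj M a).homEquiv x y).symm.injective
    (((adj M a).homEquiv_counit _ _ f).trans
      (h.trans ((adj M a).homEquiv_counit _ _ g).symm))

/-- For a triangle `a ≫ g = b`, the morphism `a^* X(s) ⟶ b^* X(t)` adjoint to the composite
`b_* a^* X(s) ≅ g_* a_* a^* X(s) ⟶ g_* X(s) ⟶ X(t)`. -/
def pullMap (X : MDiagram M) {r s t : D} (a : r ⟶ s) (g : s ⟶ t) (b : r ⟶ t) (h : a ≫ g = b) :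
    (pull M a).obj (X.obj s) ⟶ (pull M b).obj (X.obj t) :=
  (adj M b).homEquiv _ _
    ((pushComp M a g b h).hom.app ((pull M a).obj (X.obj s)) ≫
      (push M g).map ((adj M a).counit.app (X.obj s)) ≫ X.map g)

/-- The adjoint form `X(s) ⟶ a^* X(t)` of the structure morphism `a_* X(s) ⟶ X(t)`. -/
def adjMap (X : MDiagram M) {s t : D} (a : s ⟶ t) : X.obj s ⟶ (pull M a).obj (X.obj t) :=
  (adj M a).homEquiv _ _ (X.map a)

lemma map_pullMap_counit (X : MDiagram M) {r s t : D} (a : r ⟶ s) (g : s ⟶ t) (b : r ⟶ t)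
    (h : a ≫ g = b) :
    (push M b).map (X.pullMap a g b h) ≫ (adj M b).counit.app (X.obj t) =
      (pushComp M a g b h).hom.app ((pull M a).obj (X.obj s)) ≫
        (push M g).map ((adj M a).counit.app (X.obj s)) ≫ X.map g :=
  map_homEquiv_counit b _

lemma map_adjMap_counit (X : MDiagram M) {s t : D} (a : s ⟶ t) :
    (push M a).map (X.adjMap a) ≫ (adj M a).counit.app (X.obj t) = X.map a :=
  map_homEquiv_counit a _

lemma pullMap_id (X : MDiagram M) {s t : D} (a : s ⟶ t) (h : a ≫ 𝟙 t = a) :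
    X.pullMap a (𝟙 t) a h = 𝟙 _ := by
  apply pull_hom_ext a
  rw [map_pullMap_counit, X.map_id, CategoryTheory.Functor.map_id, Category.id_comp]
  refine (congrArg ((pushComp M a (𝟙 t) a h).hom.app _ ≫ ·)
    ((pushId M t).hom.naturality ((adj M a).counit.app (X.obj t)))).trans ?_
  exact (reassoc_of% (pushComp_id' M a h ((pull M a).obj (X.obj t)))) _

lemma pullMap_comp (X : MDiagram M) {s t₁ t₂ t₃ : D} (a : s ⟶ t₁) (b : s ⟶ t₂) (c : s ⟶ t₃)
    (g : t₁ ⟶ t₂) (g' : t₂ ⟶ t₃) (k : t₁ ⟶ t₃) (hk : g ≫ g' = k)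
    (h : a ≫ g = b) (h' : b ≫ g' = c) (h'' : a ≫ k = c) :
    X.pullMap a k c h'' = X.pullMap a g b h ≫ X.pullMap b g' c h' := by
  apply pull_hom_ext c
  have e := pushComp_naturality M b g' c h' (X.pullMap a g b h)
  have e' := pushComp_naturality M g g' k hk ((adj M a).counit.app (X.obj t₁))
  rw [map_pullMap_counit, Functor.map_comp, Category.assoc, map_pullMap_counit,
    reassoc_of% e, ← Functor.map_comp_assoc, map_pullMap_counit,
    ← X.map_comp' g g' k hk, reassoc_of% e', Functor.map_comp, Functor.map_comp]
  simp only [Category.assoc]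
  exact (reassoc_of% (pushComp_assoc M a g g' b k c h hk h' h''
    ((pull M a).obj (X.obj t₁)))) _

lemma pullMap_naturality {X Y : MDiagram M} (f : X ⟶ Y) {r s t : D} (a : r ⟶ s) (g : s ⟶ t)
    (b : r ⟶ t) (h : a ≫ g = b) :
    X.pullMap a g b h ≫ (pull M b).map (Hom.app f t) =
      (pull M a).map (Hom.app f s) ≫ Y.pullMap a g b h := by
  apply pull_hom_ext b
  have e := pushComp_naturality M a g b h ((pull M a).map (Hom.app f s))
  have n := (adj M b).counit.naturality (Hom.app f t)
  have n' := (adj M a).counit.naturality (Hom.app f s)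
  dsimp only [Functor.comp_map, Functor.comp_obj, Functor.id_map, Functor.id_obj] at n n'
  rw [Functor.map_comp, Functor.map_comp, Category.assoc, Category.assoc, n,
    map_pullMap_counit, reassoc_of% (map_pullMap_counit X a g b h), reassoc_of% e,
    ← Functor.map_comp_assoc, n', Functor.map_comp, Category.assoc, Hom.naturality]

lemma adjMap_pullMap (X : MDiagram M) {r s t : D} (a : r ⟶ s) (g : s ⟶ t)
    (b : r ⟶ t) (h : a ≫ g = b) : X.adjMap a ≫ X.pullMap a g b h = X.adjMap b := by
  apply pull_hom_ext b
  have e := pushComp_naturality M a g b h (X.adjMap a)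
  rw [map_adjMap_counit, Functor.map_comp, Category.assoc, map_pullMap_counit, reassoc_of% e,
    ← Functor.map_comp_assoc, map_adjMap_counit, X.map_comp' a g b h]

lemma adjMap_naturality {X Y : MDiagram M} (f : X ⟶ Y) {s t : D} (a : s ⟶ t) :
    X.adjMap a ≫ (pull M a).map (Hom.app f t) = Hom.app f s ≫ Y.adjMap a := by
  apply pull_hom_ext a
  have n := (adj M a).counit.naturality (Hom.app f t)
  dsimp only [Functor.comp_map, Functor.comp_obj, Functor.id_map, Functor.id_obj] at n
  rw [Functor.map_comp, Functor.map_comp, Category.assoc, Category.assoc, n,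
    map_adjMap_counit, reassoc_of% (map_adjMap_counit X a), Hom.naturality]

/-- The functor from the matching category of `s` to `M(s)` sending `a : s ⟶ t` to `a^* X(t)`. -/
def matchingDiagram (X : MDiagram M) (s : D) : MatchingCat s ⥤ Fiber M s where
  obj a := (pull M a.obj.hom).obj (X.obj a.obj.right)
  map {a b} g := X.pullMap a.obj.hom g.hom.right b.obj.hom (Under.w g.hom)
  map_id _ := X.pullMap_id _ _
  map_comp _ _ := X.pullMap_comp _ _ _ _ _ _ rfl _ _ _

/-- The natural transformation `a^* X(t) ⟶ a^* Y(t)` induced by a morphism `X ⟶ Y`. -/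
def matchingDiagramMap {X Y : MDiagram M} (f : X ⟶ Y) (s : D) :
    X.matchingDiagram s ⟶ Y.matchingDiagram s where
  app a := (pull M a.obj.hom).map (Hom.app f a.obj.right)
  naturality _ _ _ := pullMap_naturality f _ _ _ _

/-- The cone `X(s) ⟶ a^* X(t)` given by the adjoints of the structure maps of `X`. -/
def matchingCone (X : MDiagram M) (s : D) : Cone (X.matchingDiagram s) where
  pt := X.obj s
  π :=
    { app := fun a ↦ X.adjMap a.obj.hom
      naturality := fun _ _ _ ↦ (Category.id_comp _).trans (X.adjMap_pullMap _ _ _ _).symm }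

variable [∀ s : D, HasLimitsOfSize.{w, w} (Fiber M s)]

/-- The matching object `M_s X`. -/
abbrev matchingObj (X : MDiagram M) (s : D) : Fiber M s := limit (X.matchingDiagram s)

/-- The induced morphism `M_s X ⟶ M_s Y`. -/
def matchingMap {X Y : MDiagram M} (f : X ⟶ Y) (s : D) : X.matchingObj s ⟶ Y.matchingObj s :=
  limMap (matchingDiagramMap f s)

/-- The canonical morphism `X(s) ⟶ M_s X`. -/
def toMatching (X : MDiagram M) (s : D) : X.obj s ⟶ X.matchingObj s :=
  limit.lift (X.matchingDiagram s) (X.matchingCone s)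

lemma toMatching_naturality {X Y : MDiagram M} (f : X ⟶ Y) (s : D) :
    Hom.app f s ≫ Y.toMatching s = X.toMatching s ≫ matchingMap f s := by
  refine limit.hom_ext fun a ↦ ?_
  rw [Category.assoc, Category.assoc]
  refine (congrArg (Hom.app f s ≫ ·) (limit.lift_π (Y.matchingCone s) a)).trans ?_
  refine Eq.trans ?_ (congrArg (X.toMatching s ≫ ·)
    (limMap_π (matchingDiagramMap f s) a)).symm
  refine Eq.trans ?_ (limit.lift_π_assoc (X.matchingCone s) a _).symm
  exact (adjMap_naturality f a.obj.hom).symm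

variable [∀ s : D, HasPullbacks (Fiber M s)]

/-- The induced morphism `X(s) ⟶ Y(s) ×_{M_s Y} M_s X`. -/
def relMatchingMap {X Y : MDiagram M} (f : X ⟶ Y) (s : D) :
    X.obj s ⟶ pullback (Y.toMatching s) (matchingMap f s) :=
  pullback.lift (Hom.app f s) (X.toMatching s) (toMatching_naturality f s)

end Matching

end MDiagram

end Diagrams

end ModelDiagram

end

/-! Fix for every object `s` a functorial weak factorization system `(W₁ s, W₂ s)` on the fiber at
`s`. When the shape is direct, the morphisms whose relative latching maps lie in `W₁` and the
morphisms whose components lie in `W₂` form a functorial weak factorization system on diagrams. Both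
constructions are inductions on degree. Once lifts are known below `s`, they assemble to a map out
of the relative latching object at `s`, and a lift at `s` is a lift of the relative latching map
against the component at `s`. Likewise, given a factorization below `s`, one extends it by factoring
the map from the relative latching object to `Y(s)`. Functoriality comes from running the same
recursion for diagrams of functors and factoring the universal arrow.

Applied to (cofibrations, trivial fibrations) and (trivial cofibrations, fibrations), this gives two
systems. It remains to see that the latching cofibrations which are levelwise weak equivalences are
exactly the latching trivial cofibrations (`latching_cofibrations_inf`). Evaluation at `s` has a
right adjoint, coinduction, with values the products of the `a^* A` over `a : t ⟶ s`. It turns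
fibrations into levelwise fibrations because each `a^*` is right Quillen, so latching trivial
cofibrations are levelwise trivial cofibrations. The converse is the retract argument.

The inverse case is the dual. Diagrams are encoded by heteromorphisms `a_* x ⟶ y`, which favour
neither `a_*` nor `a^*`; reversing the edges and taking opposite categories turns matching objects
into latching objects, so lifting and factorization are proved once, for `HetSystem`. The comparison
of classes is dualized by using induction, the left adjoint of evaluation. -/

noncomputable section

namespace ModelDiagram

/-! ### Dependent choice along a well-founded order. -/

/-- Dependent choice along a well-founded order: if a value at `i` can be chosen as soon as the
values below `i` satisfy the requirement `P`, then there is a global choice satisfying `P`. -/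
theorem exists_forall_of_wellFoundedLT {I O : Type*} [Preorder O] [WellFoundedLT O] (d : I → O)
    {β : I → Type*} [∀ i, Nonempty (β i)] (P : ∀ i, (∀ j, d j < d i → β j) → β i → Prop)
    (step : ∀ i (f : ∀ j, β j), (∀ j, d j < d i → P j (fun k _ ↦ f k) (f j)) →
      ∃ b, P i (fun k _ ↦ f k) b) :
    ∃ f : ∀ i, β i, ∀ i, P i (fun k _ ↦ f k) (f i) := by
  classical
  have wf : WellFounded (fun j i : I ↦ d j < d i) := InvImage.wf d wellFounded_lt
  -- The recursion must be total, so a junk value is taken where no admissible one exists; the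
  -- induction below shows that this branch is never reached.
  let F : ∀ i, (∀ j, d j < d i → β j) → β i := fun i g ↦
    if h : ∃ b, P i g b then h.choose else Classical.arbitrary _
  have hF : ∀ i g, (∃ b, P i g b) → P i g (F i g) := fun i g h ↦ by
    simp only [F, dif_pos h]
    exact h.choose_spec
  refine ⟨wf.fix F, fun i ↦ ?_⟩
  induction i using wf.induction with
  | _ i ih =>
    rw [wf.fix_eq]
    exact hF i _ (step i _ ih)

/-! ### Systems of categories with heteromorphisms, and their diagrams. -/

/-- A system of categories `C i` indexed by the vertices of a graph `E` with a notion `T` of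
commutative triangle, with heteromorphisms along the edges of `E` which may be composed with
morphisms of the categories `C i`, and with each other along commutative triangles. -/
structure HetSystem {I : Type*} (E : I → I → Type*)
    (T : ∀ {q r s : I}, E q r → E r s → E q s → Prop)
    (C : I → Type u) [∀ i, Category.{v} (C i)] where
  /-- heteromorphisms along an edge -/
  Hom {r s : I} (e : E r s) (x : C r) (y : C s) : Type w
  /-- precomposition with a morphism -/
  pre {r s : I} {e : E r s} {x x' : C r} {y : C s} (f : x' ⟶ x) (φ : Hom e x y) : Hom e x' y
  /-- postcomposition with a morphism -/
  post {r s : I} {e : E r s} {x : C r} {y y' : C s} (φ : Hom e x y) (g : y ⟶ y') : Hom e x y'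
  /-- composition along a commutative triangle -/
  comp {q r s : I} {g : E q r} {b : E r s} {a : E q s} {x : C q} {y : C r} {z : C s}
    (t : T g b a) (φ : Hom g x y) (ψ : Hom b y z) : Hom a x z
  pre_id {r s : I} {e : E r s} {x : C r} {y : C s} (φ : Hom e x y) : pre (𝟙 x) φ = φ
  post_id {r s : I} {e : E r s} {x : C r} {y : C s} (φ : Hom e x y) : post φ (𝟙 y) = φ
  pre_comp {r s : I} {e : E r s} {x x' x'' : C r} {y : C s} (f : x'' ⟶ x') (f' : x' ⟶ x)
    (φ : Hom e x y) : pre (f ≫ f') φ = pre f (pre f' φ)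
  post_comp {r s : I} {e : E r s} {x : C r} {y y' y'' : C s} (φ : Hom e x y) (g : y ⟶ y')
    (g' : y' ⟶ y'') : post φ (g ≫ g') = post (post φ g) g'
  pre_post {r s : I} {e : E r s} {x x' : C r} {y y' : C s} (f : x' ⟶ x) (φ : Hom e x y)
    (g : y ⟶ y') : post (pre f φ) g = pre f (post φ g)
  comp_pre {q r s : I} {g : E q r} {b : E r s} {a : E q s} {x x' : C q} {y : C r}
    {z : C s} (t : T g b a) (f : x' ⟶ x) (φ : Hom g x y) (ψ : Hom b y z) :
    comp t (pre f φ) ψ = pre f (comp t φ ψ)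
  comp_post {q r s : I} {g : E q r} {b : E r s} {a : E q s} {x : C q} {y : C r}
    {z z' : C s} (t : T g b a) (φ : Hom g x y) (ψ : Hom b y z) (k : z ⟶ z') :
    comp t φ (post ψ k) = post (comp t φ ψ) k
  comp_mid {q r s : I} {g : E q r} {b : E r s} {a : E q s} {x : C q} {y y' : C r}
    {z : C s} (t : T g b a) (φ : Hom g x y) (k : y ⟶ y') (ψ : Hom b y' z) :
    comp t (post φ k) ψ = comp t φ (pre k ψ)

namespace HetSystem

variable {I : Type*} {E : I → I → Type*} {T : ∀ {q r s : I}, E q r → E r s → E q s → Prop}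
  {C : I → Type u} [∀ i, Category.{v} (C i)] (H : HetSystem.{w} E T C)

/-- The opposite system, on the opposite categories and the opposite graph. -/
def op : HetSystem.{w} (fun r s ↦ E s r) (fun g b a ↦ T b g a) (fun i ↦ (C i)ᵒᵖ) where
  Hom e x y := H.Hom e y.unop x.unop
  pre f φ := H.post φ f.unop
  post φ g := H.pre g.unop φ
  comp t φ ψ := H.comp t ψ φ
  pre_id _ := H.post_id _
  post_id _ := H.pre_id _
  pre_comp _ _ _ := H.post_comp _ _ _
  post_comp _ _ _ := H.pre_comp _ _ _
  pre_post _ _ _ := (H.pre_post _ _ _).symm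
  comp_pre t _ _ _ := H.comp_post t _ _ _
  comp_post t _ _ _ := H.comp_pre t _ _ _
  comp_mid t _ _ _ := (H.comp_mid t _ _ _).symm

/-- A diagram in a system of categories and heteromorphisms. -/
structure Diagram where
  /-- the objects of the diagram -/
  obj (i : I) : C i
  /-- the structure heteromorphisms -/
  map {r s : I} (e : E r s) : H.Hom e (obj r) (obj s)
  comp {q r s : I} {g : E q r} {b : E r s} {a : E q s} (t : T g b a) :
    H.comp t (map g) (map b) = map a

namespace Diagram

variable {H}

/-- A morphism of diagrams. -/
@[ext]
structure Hom (X Y : H.Diagram) where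
  /-- the components of a morphism of diagrams -/
  app (i : I) : X.obj i ⟶ Y.obj i
  naturality {r s : I} (e : E r s) : H.post (X.map e) (app s) = H.pre (app r) (Y.map e)

instance : Category H.Diagram where
  Hom := Hom
  id X :=
    { app := fun i ↦ 𝟙 (X.obj i)
      naturality := fun e ↦ by rw [H.pre_id, H.post_id] }
  comp f g :=
    { app := fun i ↦ f.app i ≫ g.app i
      naturality := fun e ↦ by
        rw [H.post_comp, f.naturality, H.pre_post, g.naturality, H.pre_comp] }

@[simp] lemma id_app (X : H.Diagram) (i : I) : Hom.app (𝟙 X) i = 𝟙 (X.obj i) := rfl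

@[simp] lemma comp_app {X Y Z : H.Diagram} (f : X ⟶ Y) (g : Y ⟶ Z) (i : I) :
    Hom.app (f ≫ g) i = Hom.app f i ≫ Hom.app g i := rfl

@[ext] lemma hom_ext {X Y : H.Diagram} {f g : X ⟶ Y} (h : ∀ i, Hom.app f i = Hom.app g i) :
    f = g :=
  Hom.ext (funext h)

variable (H) in
/-- Evaluation of diagrams at a vertex. -/
def eval (i : I) : H.Diagram ⥤ C i where
  obj X := X.obj i
  map f := Hom.app f i

end Diagram

open Diagram

variable {H}

/-! ### Relative latching objects by universal property. -/

/-- The predicate that `pt`, equipped with `inl` and `inr`, is a relative latching object at `s` of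
a morphism `j` out of `X` which is only given by its values `z` at the sources of the edges to `s`;
the structure maps between these values are specified by the sets `R`. -/
structure IsUniversal {X : H.Diagram} {s : I} (z : ∀ r, E r s → C r)
    (j : ∀ r (a : E r s), X.obj r ⟶ z r a)
    (R : ∀ {q r} {g : E q r} {b : E r s} {a : E q s}, T g b a → Set (H.Hom g (z q a) (z r b)))
    (pt : C s) (inl : X.obj s ⟶ pt) (inr : ∀ r (a : E r s), H.Hom a (z r a) pt) : Prop where
  w {r : I} (a : E r s) : H.post (X.map a) inl = H.pre (j r a) (inr r a)
  tri {q r : I} {g : E q r} {b : E r s} {a : E q s} (t : T g b a) (n : H.Hom g (z q a) (z r b)) :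
    n ∈ R t → H.comp t n (inr r b) = inr q a
  existsUnique_desc (W : C s) (u : X.obj s ⟶ W) (v : ∀ r (a : E r s), H.Hom a (z r a) W)
    (hw : ∀ r (a : E r s), H.post (X.map a) u = H.pre (j r a) (v r a))
    (ht : ∀ ⦃q r : I⦄ ⦃g : E q r⦄ ⦃b : E r s⦄ ⦃a : E q s⦄ (t : T g b a)
      (n : H.Hom g (z q a) (z r b)), n ∈ R t → H.comp t n (v r b) = v q a) :
    ∃! p : pt ⟶ W, inl ≫ p = u ∧ ∀ r (a : E r s), H.post (inr r a) p = v r a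

/-- A relative latching object of a morphism of diagrams. -/
structure RelLatching {X Y : H.Diagram} (f : X ⟶ Y) (s : I) where
  /-- the relative latching object -/
  pt : C s
  /-- the structure map from the source -/
  inl : X.obj s ⟶ pt
  /-- the structure maps from the target -/
  inr {r : I} (a : E r s) : H.Hom a (Y.obj r) pt
  isUniversal : IsUniversal (fun r _ ↦ Y.obj r) (fun r _ ↦ Hom.app f r)
    (fun {_ _ g _ _} _ ↦ {Y.map g}) pt inl (fun _ a ↦ inr a)

namespace RelLatching

variable {X Y X' Y' X'' Y'' : H.Diagram} {f : X ⟶ Y} {f' : X' ⟶ Y'} {f'' : X'' ⟶ Y''} {s : I}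

lemma w (L : RelLatching f s) {r : I} (a : E r s) :
    H.post (X.map a) L.inl = H.pre (Hom.app f r) (L.inr a) :=
  L.isUniversal.w a

lemma tri (L : RelLatching f s) {q r : I} {g : E q r} {b : E r s} {a : E q s} (t : T g b a) :
    H.comp t (Y.map g) (L.inr b) = L.inr a :=
  L.isUniversal.tri t _ rfl

section

variable (L : RelLatching f s) {W : C s} (u : X.obj s ⟶ W)
  (v : ∀ (r : I) (a : E r s), H.Hom a (Y.obj r) W)

lemma existsUnique_desc
    (hw : ∀ (r : I) (a : E r s), H.post (X.map a) u = H.pre (Hom.app f r) (v r a))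
    (ht : ∀ ⦃q r : I⦄ ⦃g : E q r⦄ ⦃b : E r s⦄ ⦃a : E q s⦄ (t : T g b a),
      H.comp t (Y.map g) (v r b) = v q a) :
    ∃! p : L.pt ⟶ W, L.inl ≫ p = u ∧ ∀ r (a : E r s), H.post (L.inr a) p = v r a :=
  L.isUniversal.existsUnique_desc W u v hw
    (fun _ _ _ _ _ t n hn ↦ by obtain rfl := Set.mem_singleton_iff.1 hn; exact ht t)

variable
  (hw : ∀ (r : I) (a : E r s), H.post (X.map a) u = H.pre (Hom.app f r) (v r a))
  (ht : ∀ ⦃q r : I⦄ ⦃g : E q r⦄ ⦃b : E r s⦄ ⦃a : E q s⦄ (t : T g b a),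
    H.comp t (Y.map g) (v r b) = v q a)

/-- The morphism out of a relative latching object given by its universal property. -/
def desc : L.pt ⟶ W := (L.existsUnique_desc u v hw ht).choose

@[simp]
lemma inl_desc : L.inl ≫ L.desc u v hw ht = u :=
  (L.existsUnique_desc u v hw ht).choose_spec.1.1

@[simp]
lemma inl_desc_assoc {Z : C s} (p : W ⟶ Z) : L.inl ≫ L.desc u v hw ht ≫ p = u ≫ p := by
  rw [← Category.assoc, inl_desc]

@[simp]
lemma inr_desc {r : I} (a : E r s) : H.post (L.inr a) (L.desc u v hw ht) = v r a :=
  (L.existsUnique_desc u v hw ht).choose_spec.1.2 r a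

end

lemma hom_ext (L : RelLatching f s) {W : C s} {p p' : L.pt ⟶ W} (h : L.inl ≫ p = L.inl ≫ p')
    (h' : ∀ {r : I} (a : E r s), H.post (L.inr a) p = H.post (L.inr a) p') : p = p' :=
  (L.existsUnique_desc (L.inl ≫ p') (fun _ a ↦ H.post (L.inr a) p')
    (fun _ a ↦ by rw [H.post_comp, L.w, H.pre_post])
    (fun _ _ _ _ _ t ↦ by rw [H.comp_post, L.tri])).unique ⟨h, fun _ a ↦ h' a⟩ ⟨rfl, fun _ _ ↦ rfl⟩

/-- The comparison map from a relative latching object of `f : X ⟶ Y` to `Y(s)`. -/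
def comparison (L : RelLatching f s) : L.pt ⟶ Y.obj s :=
  L.desc (Hom.app f s) (fun _ ↦ Y.map) (fun _ a ↦ Hom.naturality f a) (fun _ _ _ _ _ t ↦ Y.comp t)

@[simp]
lemma inl_comparison (L : RelLatching f s) : L.inl ≫ L.comparison = Hom.app f s :=
  L.inl_desc _ _ _ _

@[simp]
lemma inl_comparison_assoc (L : RelLatching f s) {Z : C s} (p : Y.obj s ⟶ Z) :
    L.inl ≫ L.comparison ≫ p = Hom.app f s ≫ p :=
  L.inl_desc_assoc _ _ _ _ _

@[simp]
lemma inr_comparison (L : RelLatching f s) {r : I} (a : E r s) :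
    H.post (L.inr a) L.comparison = Y.map a :=
  L.inr_desc _ _ _ _ _

/-- Functoriality of relative latching objects. -/
def map (L : RelLatching f s) (L' : RelLatching f' s) (l : X ⟶ X') (r : Y ⟶ Y')
    (h : l ≫ f' = f ≫ r) : L.pt ⟶ L'.pt :=
  L.desc (Hom.app l s ≫ L'.inl) (fun _ a ↦ H.pre (Hom.app r _) (L'.inr a))
    (fun _ a ↦ by
      rw [H.post_comp, Hom.naturality, H.pre_post, L'.w, ← H.pre_comp, ← H.pre_comp, ← comp_app,
        ← comp_app, h])
    (fun _ _ _ _ _ t ↦ by rw [← H.comp_mid, Hom.naturality, H.comp_pre, L'.tri])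

section

variable (L : RelLatching f s) (L' : RelLatching f' s) (L'' : RelLatching f'' s)
  (l : X ⟶ X') (r : Y ⟶ Y') (h : l ≫ f' = f ≫ r)

@[simp]
lemma inl_map : L.inl ≫ L.map L' l r h = Hom.app l s ≫ L'.inl :=
  L.inl_desc _ _ _ _

@[simp]
lemma inl_map_assoc {Z : C s} (p : L'.pt ⟶ Z) :
    L.inl ≫ L.map L' l r h ≫ p = Hom.app l s ≫ L'.inl ≫ p := by
  rw [← Category.assoc, inl_map, Category.assoc]

@[simp]
lemma inr_map {q : I} (a : E q s) :
    H.post (L.inr a) (L.map L' l r h) = H.pre (Hom.app r _) (L'.inr a) :=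
  L.inr_desc _ _ _ _ _

lemma map_comparison : L.map L' l r h ≫ L'.comparison = L.comparison ≫ Hom.app r s := by
  refine L.hom_ext ?_ fun a ↦ ?_
  · rw [inl_map_assoc, inl_comparison, inl_comparison_assoc, ← comp_app, ← comp_app, h]
  · rw [H.post_comp, inr_map, H.pre_post, inr_comparison, H.post_comp, inr_comparison,
      Hom.naturality]

lemma map_id (h : 𝟙 X ≫ f = f ≫ 𝟙 Y) : L.map L (𝟙 X) (𝟙 Y) h = 𝟙 _ := by
  refine L.hom_ext ?_ fun a ↦ ?_
  · simp
  · rw [inr_map, id_app, H.pre_id, H.post_id]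

lemma map_comp (l' : X' ⟶ X'') (r' : Y' ⟶ Y'') (h' : l' ≫ f'' = f' ≫ r')
    (h'' : (l ≫ l') ≫ f'' = f ≫ r ≫ r') :
    L.map L'' (l ≫ l') (r ≫ r') h'' = L.map L' l r h ≫ L'.map L'' l' r' h' := by
  refine L.hom_ext ?_ fun a ↦ ?_
  · simp
  · rw [H.post_comp, inr_map, inr_map, H.pre_post, inr_map, comp_app, H.pre_comp]

/-- Relative latching maps of retracts are retracts. -/
def retractArrow (h : RetractArrow f f') : RetractArrow L.comparison L'.comparison where
  i := Arrow.homMk (L.map L' h.i.left h.i.right h.i.w) (Hom.app h.i.right s)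
    (L.map_comparison _ _ _ _)
  r := Arrow.homMk (L'.map L h.r.left h.r.right h.r.w) (Hom.app h.r.right s)
    (L'.map_comparison _ _ _ _)
  retract := by
    ext
    · have e := L.map_comp L' L h.i.left h.i.right h.i.w h.r.left h.r.right h.r.w
        (by rw [h.retract_left, h.retract_right]; simp)
      have e' : ∀ (x : X ⟶ X) (y : Y ⟶ Y) (hxy : x ≫ f = f ≫ y), x = 𝟙 _ → y = 𝟙 _ →
          L.map L x y hxy = 𝟙 _ := by
        rintro _ _ _ rfl rfl
        exact L.map_id _
      exact e.symm.trans (e' _ _ _ h.retract_left h.retract_right)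
    · exact congrArg (fun k ↦ Hom.app k s) h.retract_right

end

end RelLatching

/-! ### Latching classes, levelwise classes and lifting. -/

/-- The morphisms of diagrams all of whose relative latching maps belong to `W`. -/
def relLatchingProperty (W : ∀ i, MorphismProperty (C i)) : MorphismProperty H.Diagram :=
  fun _ _ f ↦ ∀ s, ∃ L : RelLatching f s, W s L.comparison

/-- The morphisms of diagrams all of whose components belong to `W`. -/
def levelwiseProperty (W : ∀ i, MorphismProperty (C i)) : MorphismProperty H.Diagram :=
  fun _ _ f ↦ ∀ s, W s (Hom.app f s)

/-- Two relative latching objects of the same morphism have comparison maps that are retracts of one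
another, so for a retract-stable class the existential choice in `relLatchingProperty` is
immaterial. -/
lemma relLatchingProperty_iff {W : ∀ i, MorphismProperty (C i)}
    [∀ i, (W i).IsStableUnderRetracts] {X Y : H.Diagram} {f : X ⟶ Y}
    (L : ∀ s, RelLatching f s) :
    relLatchingProperty W f ↔ ∀ s, W s (L s).comparison := by
  refine ⟨fun h s ↦ ?_, fun h s ↦ ⟨L s, h s⟩⟩
  obtain ⟨L', hL'⟩ := h s
  exact MorphismProperty.of_retract ((L s).retractArrow L' (Retract.refl _)) hL'

/-- The lifting property against a levelwise class can be verified on relative latching maps. -/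
theorem hasLiftingProperty_of_relLatching {O : Type*} [Preorder O] [WellFoundedLT O] (d : I → O)
    (hd : ∀ {r s : I}, E r s → d r < d s) {X Y A B : H.Diagram} (i : X ⟶ Y) (p : A ⟶ B)
    (L : ∀ s, RelLatching i s) (hL : ∀ s, HasLiftingProperty (L s).comparison (Hom.app p s)) :
    HasLiftingProperty i p := by
  refine ⟨fun {top bot} sq ↦ ?_⟩
  -- Dependent choice needs nonempty types of values, while the type of maps `Y(r) ⟶ A(r)` could be
  -- empty a priori. Hence `Option`, with `P` forcing the value to be an actual lift.
  let P : ∀ s, (∀ r, d r < d s → Option (Y.obj r ⟶ A.obj r)) → Option (Y.obj s ⟶ A.obj s) → Prop :=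
    fun s f b ↦ ∃ l, b = some l ∧ Hom.app i s ≫ l = Hom.app top s ∧
      l ≫ Hom.app p s = Hom.app bot s ∧
      ∀ r (a : E r s), ∀ l' ∈ f r (hd a), H.post (Y.map a) l = H.pre l' (A.map a)
  obtain ⟨f, hf⟩ := exists_forall_of_wellFoundedLT d P (fun s f hf ↦ by
    have hf' : ∀ {r} (a : E r s), ∃ l, f r = some l := fun a ↦ (hf _ (hd a)).imp fun _ h ↦ h.1
    let l {r} (a : E r s) : Y.obj r ⟶ A.obj r := (hf' a).choose
    have fl {r} (a : E r s) : f r = some (l a) := (hf' a).choose_spec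
    have hl {r} (a : E r s) : Hom.app i r ≫ l a = Hom.app top r ∧ l a ≫ Hom.app p r = Hom.app bot r ∧
        ∀ q (g : E q r), ∀ l' ∈ f q, H.post (Y.map g) (l a) = H.pre l' (A.map g) := by
      obtain ⟨l', h, h'⟩ := hf _ (hd a)
      obtain rfl : l a = l' := Option.some_injective _ ((fl a).symm.trans h)
      exact h'
    -- The top map at `s` and the lifts already chosen below `s` glue on the relative latching
    -- object. The naturality of the earlier lifts is the compatibility along triangles.
    let t : (L s).pt ⟶ A.obj s := (L s).desc (Hom.app top s) (fun _ a ↦ H.pre (l a) (A.map a))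
      (fun _ a ↦ by rw [Hom.naturality, ← H.pre_comp, (hl a).1])
      (fun q r g b a t ↦ by
        rw [← H.comp_mid, (hl b).2.2 q g (l a) (fl a), H.comp_pre, A.comp])
    have sq' : CommSq t (L s).comparison (Hom.app p s) (Hom.app bot s) := ⟨by
      refine (L s).hom_ext ?_ fun a ↦ ?_
      · rw [(L s).inl_desc_assoc, (L s).inl_comparison_assoc, ← comp_app, ← comp_app, sq.w]
      · rw [H.post_comp, (L s).inr_desc, H.pre_post, H.post_comp, (L s).inr_comparison,
          Hom.naturality, Hom.naturality, ← H.pre_comp, (hl a).2.1]⟩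
    have := hL s
    refine ⟨some sq'.lift, sq'.lift, rfl, ?_, sq'.fac_right, fun r a l' hl' ↦ ?_⟩
    · rw [← (L s).inl_comparison, Category.assoc, sq'.fac_left, (L s).inl_desc]
    · obtain rfl : l a = l' := Option.some_injective _ ((fl a).symm.trans hl')
      rw [← (L s).inr_comparison, ← H.post_comp, sq'.fac_left, (L s).inr_desc])
  choose l hl using hf
  exact ⟨⟨{ l := { app := l, naturality := fun e ↦ (hl _).2.2.2 _ e _ (hl _).1 }
            fac_left := by ext s; exact (hl s).2.1
            fac_right := by ext s; exact (hl s).2.2.1 }⟩⟩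

end HetSystem

end ModelDiagram

/-! ### Factorizations by recursion on degree. -/

namespace ModelDiagram

namespace HetSystem

open Diagram

variable {I : Type*} {E : I → I → Type*} {T : ∀ {q r s : I}, E q r → E r s → E q s → Prop}
  {C : I → Type u} [∀ i, Category.{v} (C i)] {H : HetSystem.{w} E T C}

/-- The value at `s` of a factorization of a morphism of diagrams, together with partially defined
structure heteromorphisms from arbitrary objects. -/
structure Stage {X Y : H.Diagram} (f : X ⟶ Y) (s : I) where
  /-- the intermediate object -/
  obj : C s
  /-- the first morphism of the factorization -/
  i : X.obj s ⟶ obj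
  /-- the second morphism of the factorization -/
  p : obj ⟶ Y.obj s
  fac : i ≫ p = Hom.app f s
  /-- the partially defined structure heteromorphisms -/
  inc {r : I} (a : E r s) (W : C r) : Option (H.Hom a W obj)

namespace Stage

variable {X Y : H.Diagram} {f : X ⟶ Y}

instance (s : I) : Nonempty (Stage f s) :=
  ⟨{ obj := Y.obj s, i := Hom.app f s, p := 𝟙 _, fac := by simp, inc := fun _ _ ↦ none }⟩

/-- The condition that a stage at `s` extends a family of stages at the sources of the edges
to `s`, with its relative latching map in `W₁`, and its second morphism in `W₂`. -/
structure IsCompatible (W₁ W₂ : ∀ i, MorphismProperty (C i)) {s : I}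
    (z : ∀ r, E r s → Stage f r) (k : Stage f s) : Prop where
  mem_p : W₂ s k.p
  exists_inc {r : I} (a : E r s) : ∃ m, m ∈ k.inc a (z r a).obj
  inc_i {r : I} (a : E r s) (m : H.Hom a (z r a).obj k.obj) (hm : m ∈ k.inc a (z r a).obj) :
    H.post (X.map a) k.i = H.pre (z r a).i m
  inc_p {r : I} (a : E r s) (m : H.Hom a (z r a).obj k.obj) (hm : m ∈ k.inc a (z r a).obj) :
    H.post m k.p = H.pre (z r a).p (Y.map a)
  comp {q r : I} {g : E q r} {b : E r s} {a : E q s} (t : T g b a)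
    (n : H.Hom g (z q a).obj (z r b).obj) (m : H.Hom b (z r b).obj k.obj)
    (m' : H.Hom a (z q a).obj k.obj) (hn : n ∈ (z r b).inc g (z q a).obj)
    (hm : m ∈ k.inc b (z r b).obj) (hm' : m' ∈ k.inc a (z q a).obj) : H.comp t n m = m'
  exists_isUniversal : ∃ (pt : C s) (inl : X.obj s ⟶ pt)
    (inr : ∀ r (a : E r s), H.Hom a (z r a).obj pt) (ι : pt ⟶ k.obj),
    IsUniversal (fun r a ↦ (z r a).obj) (fun r a ↦ (z r a).i)
      (fun {q r g b a} _ ↦ {n | n ∈ (z r b).inc g (z q a).obj}) pt inl inr ∧ W₁ s ι ∧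
    inl ≫ ι = k.i ∧ ∀ r (a : E r s) (m : H.Hom a (z r a).obj k.obj),
      m ∈ k.inc a (z r a).obj → H.post (inr r a) ι = m

/-- A family of compatible stages gives a factorization. -/
lemma IsCompatible.nonempty_mapFactorizationData {W₁ W₂ : ∀ i, MorphismProperty (C i)}
    (z : ∀ s, Stage f s) (hz : ∀ s, IsCompatible W₁ W₂ (fun r _ ↦ z r) (z s)) :
    Nonempty (MorphismProperty.MapFactorizationData (relLatchingProperty W₁)
      (levelwiseProperty W₂) f) := by
  choose m hm using fun {r s : I} (a : E r s) ↦ (hz s).exists_inc a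
  let Z : H.Diagram :=
    { obj := fun s ↦ (z s).obj
      map := fun a ↦ m a
      comp := fun t ↦ (hz _).comp t _ _ _ (hm _) (hm _) (hm _) }
  let i : X ⟶ Z :=
    { app := fun s ↦ (z s).i
      naturality := fun a ↦ (hz _).inc_i a _ (hm a) }
  let p : Z ⟶ Y :=
    { app := fun s ↦ (z s).p
      naturality := fun a ↦ (hz _).inc_p a _ (hm a) }
  refine ⟨{ Z := Z, i := i, p := p, fac := by ext s; exact (z s).fac, hi := fun s ↦ ?_,
            hp := fun s ↦ (hz s).mem_p }⟩
  obtain ⟨pt, inl, inr, ι, hu, hι, hinl, hinr⟩ := (hz s).exists_isUniversal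
  let L : RelLatching i s :=
    { pt := pt
      inl := inl
      inr := fun a ↦ inr _ a
      isUniversal := by
        -- Compatibility leaves exactly one admissible structure map along each edge, so the
        -- universal property for sets of heteromorphisms becomes the one for the morphism `i` of
        -- diagrams.
        have e {q r : I} (g : E q r) : ({n | n ∈ (z r).inc g (z q).obj} : Set _) = {m g} :=
          Set.eq_singleton_iff_unique_mem.2
            ⟨hm g, fun n hn ↦ Option.mem_unique hn (hm g)⟩
        simp only [e] at hu
        exact hu }
  have hL : L.comparison = ι := L.hom_ext (by rw [L.inl_comparison]; exact hinl.symm) (fun a ↦ by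
    rw [L.inr_comparison]; exact (hinr _ a _ (hm a)).symm)
  exact ⟨L, by rwa [hL]⟩

/-- A family of stages below `s` can be extended to `s`. -/
lemma exists_isCompatible {O : Type*} [Preorder O] (d : I → O)
    (hd : ∀ {r s : I}, E r s → d r < d s) (W₁ W₂ : ∀ i, MorphismProperty (C i))
    [∀ i, (W₁ i).HasFactorization (W₂ i)]
    (hL : ∀ {X Y : H.Diagram} (f : X ⟶ Y) (s : I), Nonempty (RelLatching f s)) (s : I)
    (z : ∀ r, Stage f r) (hz : ∀ r, d r < d s → IsCompatible W₁ W₂ (fun q _ ↦ z q) (z r))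
    (hz' : ∀ r, ¬ d r < d s → IsIso (z r).p) :
    ∃ k : Stage f s, IsCompatible W₁ W₂ (fun r _ ↦ z r) k := by
  classical
  -- Relative latching objects are only available for morphisms of full diagrams, so the stages are
  -- completed to one. Below `s` the structure maps are prescribed; elsewhere `p` is invertible,
  -- which forces the structure map to be the one transported from `Y`.
  have hm : ∀ {q r : I} (e : E q r), ∃ m : H.Hom e (z q).obj (z r).obj,
      (d r < d s → m ∈ (z r).inc e (z q).obj) ∧
      H.post (X.map e) (z r).i = H.pre (z q).i m ∧ H.post m (z r).p = H.pre (z q).p (Y.map e) := by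
    intro q r e
    by_cases h : d r < d s
    · obtain ⟨m, hm⟩ := (hz r h).exists_inc e
      exact ⟨m, fun _ ↦ hm, (hz r h).inc_i e m hm, (hz r h).inc_p e m hm⟩
    · have := hz' r h
      refine ⟨H.post (H.pre (z q).p (Y.map e)) (inv (z r).p), fun h' ↦ (h h').elim, ?_, ?_⟩
      · have := (z r).fac
        rw [← IsIso.eq_comp_inv] at this
        rw [this, H.post_comp, Hom.naturality, ← H.pre_post, ← H.pre_comp, (z q).fac]
      · rw [← H.post_comp, IsIso.inv_hom_id, H.post_id]
  choose m hinc hi hp using @hm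
  let Z : H.Diagram :=
    { obj := fun s ↦ (z s).obj
      map := fun a ↦ m a
      comp := fun {q r t g b a} τ ↦ by
        by_cases h : d t < d s
        · exact (hz t h).comp τ _ _ _ (hinc _ ((hd b).trans h)) (hinc _ h) (hinc _ h)
        · have := hz' t h
          have hb (r : I) (b : E r t) : m b = H.post (H.pre (z r).p (Y.map b)) (inv (z t).p) := by
            rw [← hp, ← H.post_comp, IsIso.hom_inv_id, H.post_id]
          rw [hb _ b, hb _ a, H.comp_post, ← H.comp_mid, hp, H.comp_pre, Y.comp] }
  let i : X ⟶ Z :=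
    { app := fun s ↦ (z s).i
      naturality := fun a ↦ hi a }
  obtain ⟨L⟩ := hL i s
  -- The composite is the map from the relative latching object to `Y(s)`. The provisional value of
  -- `Z` at `s` enters only through it and is replaced by the middle object of the factorization.
  let F := MorphismProperty.factorizationData (W₁ s) (W₂ s) (L.comparison ≫ (z s).p)
  let k : Stage f s :=
    { obj := F.Z
      i := L.inl ≫ F.i
      p := F.p
      fac := by
        rw [Category.assoc, F.fac, L.inl_comparison_assoc]
        exact (z s).fac
      inc := fun {r} a W ↦ if h : W = (z r).obj then some (h ▸ H.post (L.inr a) F.i) else none }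
  have hk {r : I} (a : E r s) (n : H.Hom a (z r).obj k.obj) :
      n ∈ k.inc a (z r).obj ↔ n = H.post (L.inr a) F.i := by
    simp only [k, Option.mem_def, dite_true, Option.some_inj]
    exact eq_comm
  refine ⟨k, F.hp, fun a ↦ ⟨_, (hk a _).2 rfl⟩, fun a n hn ↦ ?_, fun a n hn ↦ ?_,
    fun {q r g b a} τ n n' n'' hn hn' hn'' ↦ ?_, L.pt, L.inl, fun r a ↦ L.inr a, F.i, ?_, F.hi, rfl,
    fun r a n hn ↦ ?_⟩
  · obtain rfl := (hk a n).1 hn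
    change H.post (X.map a) (L.inl ≫ F.i) = _
    rw [H.post_comp, L.w, H.pre_post]
  · obtain rfl := (hk a n).1 hn
    change H.post _ F.p = _
    rw [← H.post_comp, F.fac, H.post_comp, L.inr_comparison]
    exact hp a
  · obtain rfl := (hk _ _).1 hn'
    obtain rfl := (hk _ _).1 hn''
    obtain rfl := Option.mem_unique hn (hinc g (hd b))
    rw [H.comp_post]
    exact congrArg (fun x ↦ H.post x F.i) (L.tri τ)
  · have e : (fun {q r : I} {g : E q r} {b : E r s} {a : E q s} (_ : T g b a) ↦
        ({n | n ∈ (z r).inc g (z q).obj} : Set _)) = fun {q r g b a} _ ↦ {m g} := by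
      funext q r g b a _
      exact Set.eq_singleton_iff_unique_mem.2
        ⟨hinc g (hd b), fun n hn ↦ Option.mem_unique hn (hinc g (hd b))⟩
    rw [e]
    exact L.isUniversal
  · exact ((hk a n).1 hn).symm

end Stage

/-- Factorizations in the categories `C i` induce factorizations of morphisms of diagrams. -/
theorem hasFactorization_relLatchingProperty {O : Type*} [Preorder O] [WellFoundedLT O] (d : I → O)
    (hd : ∀ {r s : I}, E r s → d r < d s) (W₁ W₂ : ∀ i, MorphismProperty (C i))
    [∀ i, (W₁ i).HasFactorization (W₂ i)]
    (hL : ∀ {X Y : H.Diagram} (f : X ⟶ Y) (s : I), Nonempty (RelLatching f s)) :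
    (relLatchingProperty (H := H) W₁).HasFactorization (levelwiseProperty W₂) where
  nonempty_mapFactorizationData {X Y} f := by
    classical
    let P : ∀ s, (∀ r, d r < d s → Stage f r) → Stage f s → Prop := fun s z k ↦
      Stage.IsCompatible W₁ W₂ (fun r a ↦ z r (hd a)) k
    obtain ⟨z, hz⟩ := exists_forall_of_wellFoundedLT d P (fun s z hz ↦ by
      -- The choice principle supplies arbitrary values away from the part below `s`. They are
      -- overwritten by the factorization `f ≫ 𝟙`, whose second map is invertible, as the extension
      -- step requires.
      let z' (r : I) : Stage f r := if d r < d s then z r else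
        { obj := Y.obj r, i := Hom.app f r, p := 𝟙 _, fac := by simp, inc := fun _ _ ↦ none }
      have hz' (r : I) (h : d r < d s) : z' r = z r := if_pos h
      have hz'' (r : I) (h : d r < d s) :
          Stage.IsCompatible W₁ W₂ (fun q (_ : E q r) ↦ z' q) (z' r) := by
        have e : (fun q (_ : E q r) ↦ z' q) = fun q _ ↦ z q := by
          funext q a
          exact hz' q ((hd a).trans h)
        rw [e, hz' r h]
        exact hz r h
      obtain ⟨k, hk⟩ := Stage.exists_isCompatible d hd W₁ W₂ hL s z' hz'' (fun r h ↦ by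
        have e : z' r = _ := if_neg h
        rw [e]
        exact inferInstanceAs (IsIso (𝟙 _)))
      have e : (fun q (_ : E q s) ↦ z' q) = fun q _ ↦ z q := by
        funext q a
        exact hz' q (hd a)
      rw [e] at hk
      exact ⟨k, hk⟩)
    exact Stage.IsCompatible.nonempty_mapFactorizationData z hz

end HetSystem

end ModelDiagram

/-! ### Functorial factorizations through functor categories. -/

namespace ModelDiagram

namespace HetSystem

open Diagram

variable {I : Type*} {E : I → I → Type*} {T : ∀ {q r s : I}, E q r → E r s → E q s → Prop}
  {C : I → Type u} [∀ i, Category.{v} (C i)] {H : HetSystem.{w} E T C}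

variable (H) in
/-- The system of functor categories, with natural families of heteromorphisms. -/
def functorCategory (K : Type*) [Category* K] : HetSystem E T (fun i ↦ K ⥤ C i) where
  Hom e x y := { φ : ∀ k, H.Hom e (x.obj k) (y.obj k) //
    ∀ ⦃k k' : K⦄ (h : k ⟶ k'), H.post (φ k) (y.map h) = H.pre (x.map h) (φ k') }
  pre f φ := ⟨fun k ↦ H.pre (f.app k) (φ.1 k), fun _ _ h ↦ by
    rw [H.pre_post, φ.2, ← H.pre_comp, ← H.pre_comp, f.naturality]⟩
  post φ f := ⟨fun k ↦ H.post (φ.1 k) (f.app k), fun _ _ h ↦ by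
    rw [← H.post_comp, ← f.naturality, H.post_comp, φ.2, H.pre_post]⟩
  comp t φ ψ := ⟨fun k ↦ H.comp t (φ.1 k) (ψ.1 k), fun _ _ h ↦ by
    rw [← H.comp_post, ψ.2, ← H.comp_mid, φ.2, H.comp_pre]⟩
  pre_id _ := Subtype.ext (funext fun _ ↦ H.pre_id _)
  post_id _ := Subtype.ext (funext fun _ ↦ H.post_id _)
  pre_comp _ _ _ := Subtype.ext (funext fun _ ↦ H.pre_comp _ _ _)
  post_comp _ _ _ := Subtype.ext (funext fun _ ↦ H.post_comp _ _ _)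
  pre_post _ _ _ := Subtype.ext (funext fun _ ↦ H.pre_post _ _ _)
  comp_pre t _ _ _ := Subtype.ext (funext fun _ ↦ H.comp_pre t _ _ _)
  comp_post t _ _ _ := Subtype.ext (funext fun _ ↦ H.comp_post t _ _ _)
  comp_mid t _ _ _ := Subtype.ext (funext fun _ ↦ H.comp_mid t _ _ _)

section

variable {K : Type*} [Category* K]

/-- A functor to diagrams gives a diagram of functors. -/
def ofFunctor (X : K ⥤ H.Diagram) : (H.functorCategory K).Diagram where
  obj i := X ⋙ eval H i
  map e := ⟨fun k ↦ (X.obj k).map e, fun _ _ h ↦ (Hom.naturality (X.map h) e)⟩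
  comp t := Subtype.ext (funext fun k ↦ (X.obj k).comp t)

/-- A diagram of functors gives a functor to diagrams. -/
def toFunctor (X : (H.functorCategory K).Diagram) : K ⥤ H.Diagram where
  obj k :=
    { obj := fun i ↦ (X.obj i).obj k
      map := fun e ↦ (X.map e).1 k
      comp := fun t ↦ congrArg (fun φ ↦ φ.1 k) (X.comp t) }
  map h :=
    { app := fun i ↦ (X.obj i).map h
      naturality := fun e ↦ (X.map e).2 h }
  map_id k := by ext; exact CategoryTheory.Functor.map_id _ _
  map_comp _ _ := by ext; exact Functor.map_comp _ _ _

/-- A morphism of diagrams of functors gives a natural transformation. -/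
def toNatTrans {X Y : (H.functorCategory K).Diagram} (f : X ⟶ Y) : toFunctor X ⟶ toFunctor Y where
  app k :=
    { app := fun i ↦ (Hom.app f i).app k
      naturality := fun e ↦ congrArg (fun φ ↦ φ.1 k) (Hom.naturality f e) }
  naturality _ _ h := by ext i; exact (Hom.app f i).naturality h

/-- Relative latching objects of diagrams of functors may be computed pointwise. -/
def RelLatching.functorCategory {X Y : (H.functorCategory K).Diagram} (f : X ⟶ Y) (s : I)
    (L : ∀ k, RelLatching ((toNatTrans f).app k) s) : RelLatching f s where
  pt :=
    { obj := fun k ↦ (L k).pt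
      map := fun {k k'} h ↦ (L k).map (L k') ((toFunctor X).map h) ((toFunctor Y).map h)
        ((toNatTrans f).naturality h)
      map_id := fun k ↦ by
        simp only [CategoryTheory.Functor.map_id]
        exact (L k).map_id _
      map_comp := fun {k k' k''} h h' ↦ by
        simp only [Functor.map_comp]
        exact (L k).map_comp (L k') (L k'') _ _ _ _ _ _ _ }
  inl :=
    { app := fun k ↦ (L k).inl
      naturality := fun {k k'} h ↦ ((L k).inl_map (L k') ((toFunctor X).map h) ((toFunctor Y).map h)
        ((toNatTrans f).naturality h)).symm }
  inr a := ⟨fun k ↦ (L k).inr a, fun {k k'} h ↦ (L k).inr_map (L k') _ _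
    ((toNatTrans f).naturality h) a⟩
  isUniversal :=
    { w := fun a ↦ Subtype.ext (funext fun k ↦ (L k).w a)
      tri := fun {q r g b a} t n hn ↦ by
        obtain rfl := Set.mem_singleton_iff.1 hn
        exact Subtype.ext (funext fun k ↦ (L k).tri t)
      existsUnique_desc := fun W u v hw ht ↦ by
        let p (k : K) : (L k).pt ⟶ W.obj k := (L k).desc (u.app k) (fun r a ↦ (v r a).1 k)
          (fun r a ↦ congrArg (fun φ ↦ φ.1 k) (hw r a))
          (fun q r g b a t ↦ congrArg (fun φ ↦ φ.1 k) (ht t _ rfl))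
        have inl_p (k : K) : (L k).inl ≫ p k = u.app k := (L k).inl_desc _ _ _ _
        have inr_p (k : K) {r : I} (a : E r s) : H.post ((L k).inr a) (p k) = (v r a).1 k :=
          (L k).inr_desc _ _ _ _ _
        refine ⟨{ app := p, naturality := fun k k' h ↦ (L k).hom_ext ?_ fun a ↦ ?_ },
          ⟨?_, fun r a ↦ ?_⟩, fun p' hp' ↦ ?_⟩
        · rw [(L k).inl_map_assoc, inl_p, reassoc_of% inl_p]
          exact u.naturality h
        · rw [H.post_comp, (L k).inr_map, H.pre_post, inr_p, H.post_comp, inr_p]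
          exact ((v _ a).2 h).symm
        · ext k
          exact inl_p k
        · exact Subtype.ext (funext fun k ↦ inr_p k a)
        · ext k
          refine (L k).hom_ext ?_ fun a ↦ ?_
          · exact (congrArg (fun φ ↦ φ.app k) hp'.1).trans (inl_p k).symm
          · exact (congrArg (fun φ ↦ φ.1 k) (hp'.2 _ a)).trans (inr_p k a).symm }

/-- Both maps have the same restrictions along `inl` and `inr`. Comparing membership in `W` avoids
stating an equality of morphisms whose endpoints agree only after unfolding. -/
lemma RelLatching.functorCategory_comparison_app_iff {X Y : (H.functorCategory K).Diagram}
    (f : X ⟶ Y) (s : I) (L : ∀ k, RelLatching ((toNatTrans f).app k) s) (k : K)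
    (W : MorphismProperty (C s)) :
    W ((RelLatching.functorCategory f s L).comparison.app k) ↔ W (L k).comparison := by
  let c : (L k).pt ⟶ ((toFunctor Y).obj k).obj s :=
    (RelLatching.functorCategory f s L).comparison.app k
  have e : c = (L k).comparison := (L k).hom_ext
    ((congrArg (fun φ ↦ φ.app k) (RelLatching.functorCategory f s L).inl_comparison).trans
      (L k).inl_comparison.symm)
    (fun a ↦ (congrArg (fun φ ↦ φ.1 k)
      ((RelLatching.functorCategory f s L).inr_comparison a)).trans ((L k).inr_comparison a).symm)
  exact Iff.of_eq (congrArg (fun x : (L k).pt ⟶ ((toFunctor Y).obj k).obj s ↦ W x) e)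

end

/-- Functorial factorizations in the categories `C i` induce functorial factorizations of
morphisms of diagrams. -/
theorem hasFunctorialFactorization_relLatchingProperty {O : Type*} [Preorder O] [WellFoundedLT O]
    (d : I → O) (hd : ∀ {r s : I}, E r s → d r < d s) (W₁ W₂ : ∀ i, MorphismProperty (C i))
    [∀ i, (W₁ i).HasFunctorialFactorization (W₂ i)] [∀ i, (W₁ i).IsStableUnderRetracts]
    (hL : ∀ {X Y : H.Diagram} (f : X ⟶ Y) (s : I), Nonempty (RelLatching f s)) :
    (relLatchingProperty (H := H) W₁).HasFunctorialFactorization (levelwiseProperty W₂) := by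
  -- Functorial factorization of all morphisms is factorization of a single one: the tautological
  -- morphism from source to target, viewed as a morphism of diagrams of functors on the arrow
  -- category.
  let K := Arrow H.Diagram
  let W₁' (i : I) : MorphismProperty (K ⥤ C i) := (W₁ i).functorCategory K
  let W₂' (i : I) : MorphismProperty (K ⥤ C i) := (W₂ i).functorCategory K
  have (i : I) : (W₁' i).HasFactorization (W₂' i) := by infer_instance
  have := hasFactorization_relLatchingProperty (H := H.functorCategory K) d hd W₁' W₂'
    (fun f s ↦ ⟨RelLatching.functorCategory f s (fun k ↦ (hL _ s).some)⟩)
  let f : ofFunctor (H := H) (Arrow.leftFunc (C := H.Diagram)) ⟶ ofFunctor Arrow.rightFunc :=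
    { app := fun s ↦ Functor.whiskerRight Arrow.leftToRight (eval H s)
      naturality := fun e ↦ Subtype.ext (funext fun k ↦ Hom.naturality k.hom e) }
  let F := MorphismProperty.factorizationData (relLatchingProperty W₁') (levelwiseProperty W₂') f
  let i : Arrow.leftFunc ⟶ toFunctor F.Z := toNatTrans F.i
  let p : toFunctor F.Z ⟶ Arrow.rightFunc := toNatTrans F.p
  refine ⟨⟨{ Z := toFunctor F.Z, i := i, p := p, fac := ?_, hi := fun k s ↦ ?_,
             hp := fun k s ↦ F.hp s k }⟩⟩
  · ext k s
    exact congrArg (fun φ : _ ⟶ ofFunctor Arrow.rightFunc ↦ (Hom.app φ s).app k) F.fac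
  -- The factorization provides some relative latching object of diagrams of functors. Its
  -- comparison map has the pointwise one as a retract, and evaluating this retract at `k` gives the
  -- claim.
  · let L (k : K) : RelLatching ((toNatTrans F.i).app k) s := (hL _ s).some
    refine ⟨L k, ?_⟩
    obtain ⟨L', hL'⟩ := F.hi s
    have h := (RelLatching.functorCategory F.i s L).retractArrow L' (Retract.refl _)
    refine (RelLatching.functorCategory_comparison_app_iff F.i s L k (W₁ s)).1 ?_
    exact MorphismProperty.of_retract (P := W₁ s)
      (h.map (((evaluation K (C s)).obj k))) (hL' k)

end HetSystem

end ModelDiagram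

/-! ### `M`-diagrams as diagrams of heteromorphisms along non-identity morphisms. -/

namespace ModelDiagram

section

variable {D : Type w} [SmallCategory D]

/-- The non-identity morphisms. -/
abbrev Edge (r s : D) : Type w := { a : r ⟶ s // NonId a }

/-- The commutative triangles of non-identity morphisms. -/
abbrev Triangle {q r s : D} (g : Edge q r) (b : Edge r s) (a : Edge q s) : Prop := g.1 ≫ b.1 = a.1

lemma not_nonId_id (s : D) : ¬ NonId (𝟙 s) := fun h ↦ h ⟨s⟩

lemma IsDirect.exists_degree (h : IsDirect D) :
    ∃ (l : Ordinal.{w}) (d : D → Set.Iio l), ∀ {r s : D}, Edge r s → d r < d s := by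
  obtain ⟨l, d, hd⟩ := h
  exact ⟨l, d.obj, fun a ↦ hd a.1 a.2⟩

lemma IsInverse.exists_degree (h : IsInverse D) :
    ∃ (l : Ordinal.{w}) (d : D → Set.Iio l), ∀ {r s : D}, Edge s r → d r < d s := by
  obtain ⟨l, d, hd⟩ := h
  exact ⟨l, fun s ↦ d.obj (.op s), fun a ↦
    hd a.1.op fun h ↦ a.2 ((MorphismProperty.identities_op_iff _).1 h)⟩

/-- Identities do not factor as composites of non-identity morphisms. -/
abbrev NonIdComp (D : Type w) [SmallCategory D] : Prop :=
  ∀ {q r s : D} (a : q ⟶ r) (b : r ⟶ s), NonId a → NonId b → NonId (a ≫ b)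

/-- A composite of non-identities strictly raises the degree, so its source and target have
different degrees. -/
lemma IsDirect.nonIdComp (h : IsDirect D) : NonIdComp D := by
  obtain ⟨l, d, hd⟩ := h.exists_degree
  intro q r s a b ha hb hab
  have hlt : d q < d s := (hd ⟨a, ha⟩).trans (hd ⟨b, hb⟩)
  generalize a ≫ b = c at hab
  cases hab
  exact lt_irrefl _ hlt

lemma IsInverse.nonIdComp (h : IsInverse D) : NonIdComp D := by
  obtain ⟨l, d, hd⟩ := h.exists_degree
  intro q r s a b ha hb hab
  have hlt : d s < d q := (hd ⟨b, hb⟩).trans (hd ⟨a, ha⟩)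
  generalize a ≫ b = c at hab
  cases hab
  exact lt_irrefl _ hlt

end

section

variable {D : Type w} [SmallCategory D] (M : Pseudofunctor (LocallyDiscrete D) Cat.{v, u})

/-- The system of heteromorphisms `a_* x ⟶ y` given by a diagram of categories. -/
abbrev hetSystem : HetSystem.{v} (Edge (D := D)) Triangle (Fiber M) where
  Hom a x y := (push M a.1).obj x ⟶ y
  pre {_ _ a _ _ _} f φ := (push M a.1).map f ≫ φ
  post φ g := φ ≫ g
  comp {_ _ _ g b a x _ _} t φ ψ := (pushComp M g.1 b.1 a.1 t).hom.app x ≫ (push M b.1).map φ ≫ ψ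
  pre_id _ := by simp
  post_id _ := by simp
  pre_comp _ _ _ := by simp
  post_comp _ _ _ := by simp
  pre_post _ _ _ := by simp
  comp_pre {_ _ _ g b a _ _ _ _} t f φ ψ := by
    rw [reassoc_of% pushComp_naturality M g.1 b.1 a.1 t f, Functor.map_comp, Category.assoc]
  comp_post _ _ _ _ := by simp
  comp_mid _ _ _ _ := by simp

namespace MDiagram

open HetSystem

/-- The diagram in the system `hetSystem M` obtained by forgetting identities. -/
abbrev toDiagram : MDiagram M ⥤ (hetSystem M).Diagram where
  obj X :=
    { obj := X.obj
      map := fun a ↦ X.map a.1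
      comp := fun t ↦ X.map_comp' _ _ _ t }
  map f :=
    { app := Hom.app f
      naturality := fun a ↦ (Hom.naturality f a.1).symm }

instance : (toDiagram M).Faithful where
  map_injective h := MDiagram.Hom.ext (congrArg Diagram.Hom.app h)

/-- The target category does not record compatibility with identities; it is automatic from the
naturality of `pushId`. -/
instance : (toDiagram M).Full where
  map_surjective {A B} f := by
    let app (s : D) : A.obj s ⟶ B.obj s := Diagram.Hom.app f s
    refine ⟨{ app := app, naturality := fun {s t} a ↦ ?_ }, rfl⟩
    by_cases ha : NonId a
    · exact (Diagram.Hom.naturality f ⟨a, ha⟩).symm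
    · obtain ⟨s⟩ := not_not.1 ha
      rw [A.map_id, B.map_id]
      exact (pushId M s).hom.naturality (app s)

section

variable {M} (Z : (hetSystem M).Diagram)

/-- The structure map of an extended diagram at an identity morphism. -/
def extendMapId {s t : D} (h : s = t) (a : s ⟶ t) (ha : a = eqToHom h) :
    (push M a).obj (Z.obj s) ⟶ Z.obj t := by
  subst h
  subst ha
  exact (pushId M s).hom.app (Z.obj s)

lemma exists_eq_eqToHom_of_not_nonId {s t : D} (a : s ⟶ t) (ha : ¬ NonId a) :
    ∃ h : s = t, a = eqToHom h := by
  obtain ⟨s⟩ := not_not.1 ha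
  exact ⟨rfl, rfl⟩

open Classical in
/-- The extension to all morphisms of the structure maps of a diagram. -/
def extendMap {s t : D} (a : s ⟶ t) : (push M a).obj (Z.obj s) ⟶ Z.obj t :=
  if h : NonId a then Z.map ⟨a, h⟩ else
    extendMapId Z (exists_eq_eqToHom_of_not_nonId a h).choose a
      (exists_eq_eqToHom_of_not_nonId a h).choose_spec

lemma extendMap_nonId {s t : D} (a : s ⟶ t) (h : NonId a) : extendMap Z a = Z.map ⟨a, h⟩ :=
  dif_pos h

lemma extendMap_id (s : D) : extendMap Z (𝟙 s) = (pushId M s).hom.app (Z.obj s) :=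
  dif_neg (not_nonId_id s)

/-- If one factor is an identity, this is a unit coherence of the pseudofunctor. Otherwise
`NonIdComp` guarantees that the composite is again an edge and the composition law of `Z` applies.
-/
lemma extendMap_comp (hD : NonIdComp D) {q r s : D} (a : q ⟶ r) (b : r ⟶ s) (c : q ⟶ s)
    (h : a ≫ b = c) : extendMap Z c =
      (pushComp M a b c h).hom.app (Z.obj q) ≫ (push M b).map (extendMap Z a) ≫ extendMap Z b := by
  by_cases ha : NonId a
  · by_cases hb : NonId b
    · have hc : NonId c := h ▸ hD a b ha hb
      rw [extendMap_nonId Z a ha, extendMap_nonId Z b hb, extendMap_nonId Z c hc]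
      exact (Z.comp (g := ⟨a, ha⟩) (b := ⟨b, hb⟩) (a := ⟨c, hc⟩) h).symm
    · obtain ⟨r⟩ := not_not.1 hb
      obtain rfl : a = c := by simpa using h
      rw [extendMap_id]
      have := (pushId M r).hom.naturality (extendMap Z a)
      dsimp only [Functor.id_obj, Functor.id_map] at this
      rw [this, reassoc_of% pushComp_id' M a h]
  · obtain ⟨q⟩ := not_not.1 ha
    obtain rfl : b = c := by simpa using h
    rw [extendMap_id, reassoc_of% pushComp_id M b h]

/-- The extension of a diagram by identities. -/
def ofDiagram (hD : NonIdComp D) : MDiagram M where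
  obj := Z.obj
  map := extendMap Z
  map_id := extendMap_id Z
  map_comp a b := extendMap_comp Z hD a b _ rfl

end

/-- Identities carry no information, so one may work only with edges, along which the degree changes
strictly. This is what makes well-founded recursion possible. -/
lemma isEquivalence_toDiagram (hD : NonIdComp D) : (toDiagram M).IsEquivalence where
  -- On edges the extended structure maps are those of `Z`, so restricting the extension gives back
  -- `Z` on the nose and the isomorphism comes from an equality.
  essSurj := ⟨fun Z ↦ ⟨ofDiagram Z hD, ⟨eqToIso (by
    have h : (fun {r s : D} (a : Edge r s) ↦ extendMap Z a.1) = @HetSystem.Diagram.map _ _ _ _ _ _ Z := by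
      funext r s a
      exact extendMap_nonId Z a.1 a.2
    cases Z
    dsimp only at h
    simp only [ofDiagram, h])⟩⟩⟩

end MDiagram

end

/-! ### Duality for systems of heteromorphisms. -/

namespace HetSystem

variable {I : Type*} {E : I → I → Type*} {T : ∀ {q r s : I}, E q r → E r s → E q s → Prop}
  {C : I → Type u} [∀ i, Category.{v} (C i)] (H : HetSystem.{w} E T C)

/-- Diagrams in the opposite system are opposite diagrams. -/
abbrev opDiagram : H.Diagramᵒᵖ ⥤ H.op.Diagram where
  obj X :=
    { obj := fun i ↦ .op (X.unop.obj i)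
      map := fun e ↦ X.unop.map e
      comp := fun t ↦ X.unop.comp t }
  map f :=
    { app := fun i ↦ (Diagram.Hom.app f.unop i).op
      naturality := fun e ↦ (Diagram.Hom.naturality f.unop e).symm }

instance : H.opDiagram.IsEquivalence where
  faithful := ⟨fun {X Y f g} h ↦ Quiver.Hom.unop_inj (Diagram.hom_ext fun i ↦ by
    exact congrArg (fun φ ↦ (Diagram.Hom.app φ i).unop) h)⟩
  full := ⟨fun {X Y} f ↦ ⟨Quiver.Hom.op
    { app := fun i ↦ (Diagram.Hom.app f i).unop
      naturality := fun e ↦ (Diagram.Hom.naturality f e).symm }, rfl⟩⟩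
  essSurj := ⟨fun Z ↦ ⟨.op
    { obj := fun i ↦ (Z.obj i).unop
      map := fun e ↦ Z.map e
      comp := fun t ↦ Z.comp t }, ⟨Iso.refl _⟩⟩⟩

end HetSystem

end ModelDiagram

/-! ### Latching and matching objects as relative latching objects. -/

namespace ModelDiagram

namespace HetSystem

open Diagram

variable {I : Type*} {E : I → I → Type*} {T : ∀ {q r s : I}, E q r → E r s → E q s → Prop}
  {C : I → Type u} [∀ i, Category.{v} (C i)] {H : HetSystem.{w} E T C}

/-- Relative latching objects are invariant under isomorphisms of arrows. -/
def RelLatching.ofIso {X Y X' Y' : H.Diagram} {f : X ⟶ Y} {f' : X' ⟶ Y'} {s : I}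
    (L : RelLatching f s) (l : X ≅ X') (r : Y ≅ Y') (h : l.hom ≫ f' = f ≫ r.hom) :
    RelLatching f' s where
  pt := L.pt
  inl := Hom.app l.inv s ≫ L.inl
  inr a := H.pre (Hom.app r.inv _) (L.inr a)
  isUniversal :=
    { w := fun {q} a ↦ by
        have h' : l.inv ≫ f = f' ≫ r.inv := by
          rw [Iso.inv_comp_eq, ← Category.assoc, h, Category.assoc, r.hom_inv_id, Category.comp_id]
        rw [H.post_comp, Hom.naturality, H.pre_post, L.w, ← H.pre_comp, ← H.pre_comp, ← comp_app,
          ← comp_app, h']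
      tri := fun t n hn ↦ by
        obtain rfl := Set.mem_singleton_iff.1 hn
        rw [← H.comp_mid, Hom.naturality, H.comp_pre, L.tri]
      existsUnique_desc := fun W u v hw ht ↦ by
        have hr (i : I) : Hom.app r.inv i ≫ Hom.app r.hom i = 𝟙 _ := by
          rw [← comp_app, r.inv_hom_id, id_app]
        have hr' (i : I) : Hom.app r.hom i ≫ Hom.app r.inv i = 𝟙 _ := by
          rw [← comp_app, r.hom_inv_id, id_app]
        have hl (i : I) : Hom.app l.inv i ≫ Hom.app l.hom i = 𝟙 _ := by
          rw [← comp_app, l.inv_hom_id, id_app]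
        have hl' (i : I) : Hom.app l.hom i ≫ Hom.app l.inv i = 𝟙 _ := by
          rw [← comp_app, l.hom_inv_id, id_app]
        refine ⟨L.desc (Hom.app l.hom s ≫ u) (fun q a ↦ H.pre (Hom.app r.hom q) (v q a))
          (fun q a ↦ ?_) (fun q q' g b a t ↦ ?_), ⟨?_, fun q a ↦ ?_⟩, fun p hp ↦ ?_⟩
        · rw [H.post_comp, Hom.naturality, H.pre_post, hw, ← H.pre_comp, ← H.pre_comp, ← comp_app,
            ← comp_app, h]
        · rw [← H.comp_mid, Hom.naturality, H.comp_pre, ht t _ rfl]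
        · rw [Category.assoc, L.inl_desc, ← Category.assoc, hl, Category.id_comp]
        · rw [H.pre_post, L.inr_desc, ← H.pre_comp, hr, H.pre_id]
        · refine L.hom_ext ?_ fun a ↦ ?_
          · rw [L.inl_desc, ← hp.1, Category.assoc, ← Category.assoc (Hom.app l.hom s), hl',
              Category.id_comp]
          · rw [L.inr_desc, ← hp.2, H.pre_post, ← H.pre_comp, hr', H.pre_id] }

/-- Every morphism of diagrams is isomorphic, as an arrow, to the image of a morphism of `𝒜`. -/
lemma nonempty_relLatching_of_isEquivalence {𝒜 : Type*} [Category* 𝒜] (F : 𝒜 ⥤ H.Diagram)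
    [F.IsEquivalence] (hF : ∀ {X Y : 𝒜} (f : X ⟶ Y) (s : I), Nonempty (RelLatching (F.map f) s))
    {X Y : H.Diagram} (f : X ⟶ Y) (s : I) : Nonempty (RelLatching f s) := by
  obtain ⟨L⟩ := hF (F.preimage ((F.objObjPreimageIso X).hom ≫ f ≫ (F.objObjPreimageIso Y).inv)) s
  exact ⟨L.ofIso (F.objObjPreimageIso X) (F.objObjPreimageIso Y) (by simp)⟩

end HetSystem

section

open HetSystem

variable {D : Type w} [SmallCategory D] {M : Pseudofunctor (LocallyDiscrete D) Cat.{v, u}}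

namespace MDiagram

section Latching

/-- A morphism of the latching category may lie over an identity, which `Triangle` excludes. The
additional cocone conditions are trivial, so compatibility along triangles of edges suffices. -/
lemma pushMap_comp_eq (X : MDiagram M) {s : D} {W : Fiber M s}
    (v : ∀ (r : D) (a : Edge r s), (push M a.1).obj (X.obj r) ⟶ W)
    (hv : ∀ {q r : D} {g : Edge q r} {b : Edge r s} {a : Edge q s} (t : Triangle g b a),
      (hetSystem M).comp t (X.map g.1) (v r b) = v q a)
    {q r : D} (g : q ⟶ r) (b : Edge r s) (a : Edge q s) (h : g ≫ b.1 = a.1) :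
    X.pushMap g b.1 a.1 h ≫ v r b = v q a := by
  by_cases hg : NonId g
  · exact (Category.assoc _ _ _).trans (hv (g := ⟨g, hg⟩) h)
  · obtain ⟨q⟩ := not_not.1 hg
    obtain rfl : b = a := Subtype.ext (by simpa using h)
    rw [pushMap_id, Category.id_comp]

variable [∀ s : D, HasColimitsOfSize.{w, w} (Fiber M s)]

/-- The object of the latching category given by a non-identity morphism. -/
abbrev latchingIndex {r s : D} (a : Edge r s) : LatchingCat s := ⟨Over.mk a.1, a.2⟩

/-- The canonical map `a_* X(r) ⟶ L_s X`. -/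
def latchingι (X : MDiagram M) {s r : D} (a : Edge r s) :
    (push M a.1).obj (X.obj r) ⟶ X.latchingObj s :=
  colimit.ι (X.latchingDiagram s) (latchingIndex a)

/-- The restriction to `a_* X(r)` of a map `L_s X ⟶ W`. -/
def latchingInj (X : MDiagram M) {s r : D} (a : Edge r s) {W : Fiber M s}
    (p : X.latchingObj s ⟶ W) : (push M a.1).obj (X.obj r) ⟶ W :=
  X.latchingι a ≫ p

lemma latchingInj_comp (X : MDiagram M) {s r : D} (a : Edge r s) {W W' : Fiber M s}
    (p : X.latchingObj s ⟶ W) (k : W ⟶ W') :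
    X.latchingInj a p ≫ k = X.latchingInj a (p ≫ k) :=
  Category.assoc _ _ _

lemma latchingInj_latchingTo (X : MDiagram M) {s r : D} (a : Edge r s) :
    X.latchingInj a (X.latchingTo s) = X.map a.1 :=
  colimit.ι_desc (X.latchingCocone s) (latchingIndex a)

lemma latchingInj_latchingMap {X Y : MDiagram M} (f : X ⟶ Y) {s r : D} (a : Edge r s)
    {W : Fiber M s} (p : Y.latchingObj s ⟶ W) :
    X.latchingInj a (latchingMap f s ≫ p) = (push M a.1).map (Hom.app f r) ≫ Y.latchingInj a p :=
  (ι_colimMap_assoc (latchingDiagramMap f s) (latchingIndex a) p)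

lemma latching_hom_ext (X : MDiagram M) {s : D} {W : Fiber M s} {p p' : X.latchingObj s ⟶ W}
    (h : ∀ (r : D) (a : Edge r s), X.latchingInj a p = X.latchingInj a p') : p = p' :=
  colimit.hom_ext fun A ↦ h A.obj.left ⟨A.obj.hom, A.property⟩

lemma comp_latchingInj (X : MDiagram M) {s q r : D} {W : Fiber M s} (p : X.latchingObj s ⟶ W)
    {g : Edge q r} {b : Edge r s} {a : Edge q s} (t : Triangle g b a) :
    (hetSystem M).comp t (X.map g.1) (X.latchingInj b p) = X.latchingInj a p := by
  let φ : latchingIndex a ⟶ latchingIndex b := ObjectProperty.homMk (Over.homMk g.1 t)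
  have h : X.pushMap g.1 b.1 a.1 t ≫ X.latchingι b = X.latchingι a := colimit.w (X.latchingDiagram s) φ
  rw [latchingInj, latchingInj, ← h, pushMap, Category.assoc, Category.assoc]

/-- Existence half of the universal property of `L_s X`, expressed through edges and triangles
instead of cocones on the latching category. -/
lemma exists_latchingInj_eq (X : MDiagram M) {s : D} {W : Fiber M s}
    (v : ∀ (r : D) (a : Edge r s), (push M a.1).obj (X.obj r) ⟶ W)
    (hv : ∀ {q r : D} {g : Edge q r} {b : Edge r s} {a : Edge q s} (t : Triangle g b a),
      (hetSystem M).comp t (X.map g.1) (v r b) = v q a) :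
    ∃ p : X.latchingObj s ⟶ W, ∀ (r : D) (a : Edge r s), X.latchingInj a p = v r a := by
  let c : Cocone (X.latchingDiagram s) :=
    { pt := W
      ι :=
        { app := fun A ↦ v A.obj.left ⟨A.obj.hom, A.property⟩
          naturality := fun A B g ↦
            (X.pushMap_comp_eq v hv g.hom.left ⟨B.obj.hom, B.property⟩
              ⟨A.obj.hom, A.property⟩ (Over.w g.hom)).trans (Category.comp_id _).symm } }
  exact ⟨colimit.desc _ c, fun r a ↦ colimit.ι_desc c (latchingIndex a)⟩

variable [∀ s : D, HasPushouts (Fiber M s)]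

/-- The pushout `X(s) ⨿_{L_s X} L_s Y` is a relative latching object. -/
def relLatching {X Y : MDiagram M} (f : X ⟶ Y) (s : D) : RelLatching ((toDiagram M).map f) s where
  pt := pushout (X.latchingTo s) (latchingMap f s)
  inl := pushout.inl _ _
  inr a := Y.latchingInj a (pushout.inr _ _)
  isUniversal :=
    { w := fun {r} a ↦ by
        change X.map a.1 ≫ pushout.inl _ _ =
          (push M a.1).map (Hom.app f r) ≫ Y.latchingInj a (pushout.inr _ _)
        rw [← latchingInj_latchingMap, ← pushout.condition, ← latchingInj_comp,
          latchingInj_latchingTo]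
      tri := fun {q r g b a} t n hn ↦ by
        obtain rfl := Set.mem_singleton_iff.1 hn
        exact Y.comp_latchingInj _ t
      existsUnique_desc := fun W u v hw ht ↦ by
        obtain ⟨p, hp⟩ := Y.exists_latchingInj_eq v (fun t ↦ ht t _ rfl)
        -- Testing on each `a_* X(r)` turns the pushout condition into the compatibility of `u` with
        -- the family `v`.
        have e : X.latchingTo s ≫ u = latchingMap f s ≫ p :=
          X.latching_hom_ext fun r a ↦ by
            rw [latchingInj_latchingMap, hp, ← latchingInj_comp, latchingInj_latchingTo]
            exact hw r a
        refine ⟨pushout.desc u p e, ⟨pushout.inl_desc _ _ e, fun r a ↦ ?_⟩, fun k hk ↦ ?_⟩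
        · change Y.latchingInj a (pushout.inr _ _) ≫ pushout.desc u p e = _
          rw [latchingInj_comp, pushout.inr_desc, hp]
        · refine pushout.hom_ext (hk.1.trans (pushout.inl_desc _ _ e).symm)
            (Y.latching_hom_ext fun r a ↦ ?_)
          rw [pushout.inr_desc, hp, ← latchingInj_comp]
          exact hk.2 r a }

lemma relLatching_comparison {X Y : MDiagram M} (f : X ⟶ Y) (s : D) :
    (relLatching f s).comparison = relLatchingMap f s := by
  refine (relLatching f s).hom_ext ?_ fun {r} a ↦ ?_
  · rw [RelLatching.inl_comparison]
    exact (pushout.inl_desc _ _ (latchingTo_naturality f s)).symm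
  · rw [RelLatching.inr_comparison]
    change Y.map a.1 = Y.latchingInj a (pushout.inr _ _) ≫ relLatchingMap f s
    rw [latchingInj_comp, relLatchingMap, pushout.inr_desc, latchingInj_latchingTo]

end Latching

section Matching

variable [∀ (s t : D) (a : s ⟶ t), (push M a).IsLeftAdjoint]

/-- Transposing along the adjunctions turns the cone condition into compatibility along triangles;
identities again contribute nothing. -/
lemma homEquiv_comp_pullMap (X : MDiagram M) {s : D} {W : Fiber M s}
    (v : ∀ (r : D) (a : Edge s r), (push M a.1).obj W ⟶ X.obj r)
    (hv : ∀ {q r : D} {g : Edge q r} {b : Edge s q} {a : Edge s r} (t : Triangle b g a),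
      (hetSystem M).comp t (v q b) (X.map g.1) = v r a)
    {q r : D} (g : q ⟶ r) (b : Edge s q) (a : Edge s r) (h : b.1 ≫ g = a.1) :
    (adj M b.1).homEquiv _ _ (v q b) ≫ X.pullMap b.1 g a.1 h =
      (adj M a.1).homEquiv _ _ (v r a) := by
  by_cases hg : NonId g
  · apply pull_hom_ext a.1
    rw [Functor.map_comp, Category.assoc, map_pullMap_counit, map_homEquiv_counit,
      reassoc_of% pushComp_naturality M b.1 g a.1 h, ← Functor.map_comp_assoc, map_homEquiv_counit]
    exact hv (g := ⟨g, hg⟩) h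
  · obtain ⟨q⟩ := not_not.1 hg
    obtain rfl : b = a := Subtype.ext (by simpa using h)
    rw [pullMap_id, Category.comp_id]

variable [∀ s : D, HasLimitsOfSize.{w, w} (Fiber M s)]

/-- The object of the matching category given by a non-identity morphism. -/
abbrev matchingIndex {s r : D} (a : Edge s r) : MatchingCat s := ⟨Under.mk a.1, a.2⟩

variable (M) in
/-- Diagrams as diagrams in the opposite system of heteromorphisms. -/
abbrev toOpDiagram : (MDiagram M)ᵒᵖ ⥤ (hetSystem M).op.Diagram :=
  (toDiagram M).op ⋙ (hetSystem M).opDiagram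

/-- The canonical map `M_s X ⟶ a^* X(r)`. -/
def matchingπ (X : MDiagram M) {s r : D} (a : Edge s r) :
    X.matchingObj s ⟶ (pull M a.1).obj (X.obj r) :=
  limit.π (X.matchingDiagram s) (matchingIndex a)

/-- The map `a_* W ⟶ X(r)` adjoint to the projection of a map `W ⟶ M_s X`. -/
def matchingProj (X : MDiagram M) {s r : D} (a : Edge s r) {W : Fiber M s}
    (p : W ⟶ X.matchingObj s) : (push M a.1).obj W ⟶ X.obj r :=
  (push M a.1).map (p ≫ X.matchingπ a) ≫
    (adj M a.1).counit.app (X.obj r)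

lemma map_matchingProj (X : MDiagram M) {s r : D} (a : Edge s r) {W W' : Fiber M s} (k : W' ⟶ W)
    (p : W ⟶ X.matchingObj s) :
    (push M a.1).map k ≫ X.matchingProj a p = X.matchingProj a (k ≫ p) := by
  rw [matchingProj, matchingProj, Category.assoc, Functor.map_comp _ k, Category.assoc]

lemma matchingProj_toMatching (X : MDiagram M) {s r : D} (a : Edge s r) :
    X.matchingProj a (X.toMatching s) = X.map a.1 := by
  have h : X.toMatching s ≫ X.matchingπ a = X.adjMap a.1 :=
    limit.lift_π (X.matchingCone s) (matchingIndex a)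
  rw [matchingProj, h]
  exact map_adjMap_counit X a.1

lemma matchingProj_matchingMap {X Y : MDiagram M} (f : X ⟶ Y) {s r : D} (a : Edge s r)
    {W : Fiber M s} (p : W ⟶ X.matchingObj s) :
    Y.matchingProj a (p ≫ matchingMap f s) = X.matchingProj a p ≫ Hom.app f r := by
  have h : matchingMap f s ≫ Y.matchingπ a =
        X.matchingπ a ≫ (pull M a.1).map (Hom.app f r) :=
    limMap_π (matchingDiagramMap f s) (matchingIndex a)
  have n := (adj M a.1).counit.naturality (Hom.app f r)
  dsimp only [Functor.comp_map, Functor.comp_obj, Functor.id_map, Functor.id_obj] at n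
  rw [matchingProj, Category.assoc, h, ← Category.assoc, Functor.map_comp, Category.assoc, n,
    ← Category.assoc, matchingProj]

lemma matching_hom_ext (X : MDiagram M) {s : D} {W : Fiber M s} {p p' : W ⟶ X.matchingObj s}
    (h : ∀ (r : D) (a : Edge s r), X.matchingProj a p = X.matchingProj a p') : p = p' :=
  limit.hom_ext fun A ↦ pull_hom_ext A.obj.hom (h A.obj.right ⟨A.obj.hom, A.property⟩)

lemma comp_matchingProj (X : MDiagram M) {s q r : D} {W : Fiber M s} (p : W ⟶ X.matchingObj s)
    {g : Edge q r} {b : Edge s q} {a : Edge s r} (t : Triangle b g a) :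
    (hetSystem M).comp t (X.matchingProj b p) (X.map g.1) = X.matchingProj a p := by
  let φ : matchingIndex b ⟶ matchingIndex a := ObjectProperty.homMk (Under.homMk g.1 t)
  have h : X.matchingπ b ≫ X.pullMap b.1 g.1 a.1 t =
    X.matchingπ a := limit.w (X.matchingDiagram s) φ
  have n := map_pullMap_counit X b.1 g.1 a.1 t
  rw [matchingProj, matchingProj, ← h, ← Category.assoc, Functor.map_comp _ (p ≫ _),
    Category.assoc, n]
  rw [reassoc_of% pushComp_naturality M b.1 g.1 a.1 t]
  simp

lemma exists_matchingProj_eq (X : MDiagram M) {s : D} {W : Fiber M s}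
    (v : ∀ (r : D) (a : Edge s r), (push M a.1).obj W ⟶ X.obj r)
    (hv : ∀ {q r : D} {g : Edge q r} {b : Edge s q} {a : Edge s r} (t : Triangle b g a),
      (hetSystem M).comp t (v q b) (X.map g.1) = v r a) :
    ∃ p : W ⟶ X.matchingObj s, ∀ (r : D) (a : Edge s r), X.matchingProj a p = v r a := by
  let c : Cone (X.matchingDiagram s) :=
    { pt := W
      π :=
        { app := fun A ↦ (adj M A.obj.hom).homEquiv _ _ (v A.obj.right ⟨A.obj.hom, A.property⟩)
          naturality := fun A B g ↦ (Category.id_comp _).trans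
            (X.homEquiv_comp_pullMap v hv g.hom.right ⟨A.obj.hom, A.property⟩
              ⟨B.obj.hom, B.property⟩ (Under.w g.hom)).symm } }
  refine ⟨limit.lift _ c, fun r a ↦ ?_⟩
  have h : limit.lift _ c ≫ X.matchingπ a =
    (adj M a.1).homEquiv _ _ (v r a) := limit.lift_π c (matchingIndex a)
  rw [matchingProj, h]
  exact map_homEquiv_counit a.1 _

variable [∀ s : D, HasPullbacks (Fiber M s)]

/-- The pullback `Y(s) ×_{M_s Y} M_s X` is a relative latching object in the opposite system. -/
def relMatching {X Y : MDiagram M} (f : X ⟶ Y) (s : D) :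
    RelLatching ((toOpDiagram M).map f.op) s where
  pt := .op (pullback (Y.toMatching s) (matchingMap f s))
  inl := (pullback.fst _ _).op
  inr a := X.matchingProj a (pullback.snd _ _)
  isUniversal :=
    { w := fun {r} a ↦ by
        change (push M a.1).map (pullback.fst _ _) ≫ Y.map a.1 =
          X.matchingProj a (pullback.snd _ _) ≫ Hom.app f r
        rw [← matchingProj_matchingMap, ← pullback.condition, ← map_matchingProj,
          matchingProj_toMatching]
      tri := fun {q r g b a} t n hn ↦ by
        obtain rfl := Set.mem_singleton_iff.1 hn
        exact X.comp_matchingProj _ t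
      existsUnique_desc := fun W u v hw ht ↦ by
        obtain ⟨p, hp⟩ := X.exists_matchingProj_eq (W := W.unop) v (fun t ↦ ht t _ rfl)
        have e : u.unop ≫ Y.toMatching s = p ≫ matchingMap f s :=
          Y.matching_hom_ext fun r a ↦ by
            rw [matchingProj_matchingMap, hp, ← map_matchingProj, matchingProj_toMatching]
            exact hw r a
        refine ⟨(pullback.lift u.unop p e).op, ⟨?_, fun r a ↦ ?_⟩, fun k hk ↦ ?_⟩
        · exact congrArg Quiver.Hom.op (pullback.lift_fst _ _ e)
        · change (push M a.1).map (pullback.lift u.unop p e) ≫ _ = _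
          rw [map_matchingProj, pullback.lift_snd, hp]
        · refine Quiver.Hom.unop_inj (pullback.hom_ext ?_ (X.matching_hom_ext fun r a ↦ ?_))
          · exact (congrArg Quiver.Hom.unop hk.1).trans (pullback.lift_fst _ _ e).symm
          · change _ = X.matchingProj a (pullback.lift u.unop p e ≫ _)
            rw [pullback.lift_snd, hp, ← map_matchingProj]
            exact hk.2 r a }

lemma relMatching_comparison {X Y : MDiagram M} (f : X ⟶ Y) (s : D) :
    (relMatching f s).comparison = (relMatchingMap f s).op := by
  refine (relMatching f s).hom_ext ?_ fun {r} a ↦ ?_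
  · rw [RelLatching.inl_comparison]
    exact (congrArg Quiver.Hom.op (pullback.lift_fst _ _ (toMatching_naturality f s))).symm
  · rw [RelLatching.inr_comparison]
    change X.map a.1 = (push M a.1).map (relMatchingMap f s) ≫ X.matchingProj a (pullback.snd _ _)
    rw [map_matchingProj, relMatchingMap, pullback.lift_snd, matchingProj_toMatching]

end Matching

end MDiagram

end

end ModelDiagram

/-! ### Right and left adjoints of evaluation: coinduction and induction. -/

namespace ModelDiagram

namespace MDiagram

variable {D : Type w} [SmallCategory D] {M : Pseudofunctor (LocallyDiscrete D) Cat.{v, u}}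

variable (M) in
/-- Evaluation of `M`-diagrams. -/
def evaluation (s : D) : MDiagram M ⥤ Fiber M s where
  obj X := X.obj s
  map f := Hom.app f s

lemma hom_ext {X Y : MDiagram M} {f g : X ⟶ Y} (h : ∀ s, Hom.app f s = Hom.app g s) : f = g :=
  Hom.ext (funext h)

section Coinduced

variable [∀ (s t : D) (a : s ⟶ t), (push M a).IsLeftAdjoint]
  [∀ s : D, HasLimitsOfSize.{w, w} (Fiber M s)] {s : D} (A : Fiber M s)

/-- The object at `t` of the `M`-diagram coinduced by an object of `M(s)`. -/
abbrev coindObj (t : D) : Fiber M t := ∏ᶜ fun a : t ⟶ s ↦ (pull M a).obj A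

/-- The universal maps from the objects of the coinduced `M`-diagram. -/
def coindε {t : D} (a : t ⟶ s) : (push M a).obj (coindObj A t) ⟶ A :=
  (push M a).map (Pi.π (fun a : t ⟶ s ↦ (pull M a).obj A) a) ≫ (adj M a).counit.app A

variable {A}

lemma coind_hom_ext {t : D} {W : Fiber M t} {f g : W ⟶ coindObj A t}
    (h : ∀ a : t ⟶ s, (push M a).map f ≫ coindε A a = (push M a).map g ≫ coindε A a) : f = g := by
  refine Pi.hom_ext _ _ fun a ↦ pull_hom_ext a ?_
  have := h a
  rwa [coindε, ← Functor.map_comp_assoc, ← Functor.map_comp_assoc] at this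

/-- The universal property of the objects of the coinduced `M`-diagram. -/
def coindLift {t : D} {W : Fiber M t} (φ : ∀ a : t ⟶ s, (push M a).obj W ⟶ A) :
    W ⟶ coindObj A t :=
  Pi.lift fun a ↦ (adj M a).homEquiv _ _ (φ a)

lemma coindLift_ε {t : D} {W : Fiber M t} (φ : ∀ a : t ⟶ s, (push M a).obj W ⟶ A) (a : t ⟶ s) :
    (push M a).map (coindLift φ) ≫ coindε A a = φ a := by
  have h : coindLift φ ≫ Pi.π (fun a : t ⟶ s ↦ (pull M a).obj A) a =
    (adj M a).homEquiv _ _ (φ a) := Limits.Pi.lift_π _ _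
  rw [coindε, ← Functor.map_comp_assoc, h, map_homEquiv_counit]

variable (A) in
/-- The structure maps of the coinduced `M`-diagram. -/
def coindMap {t t' : D} (b : t ⟶ t') : (push M b).obj (coindObj A t) ⟶ coindObj A t' :=
  coindLift fun c ↦ (pushComp M b c (b ≫ c) rfl).inv.app (coindObj A t) ≫ coindε A (b ≫ c)

lemma coindMap_ε {t t' : D} (b : t ⟶ t') (c : t' ⟶ s) (d : t ⟶ s) (h : b ≫ c = d) :
    (pushComp M b c d h).hom.app (coindObj A t) ≫ (push M c).map (coindMap A b) ≫ coindε A c =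
      coindε A d := by
  subst h
  rw [coindMap, coindLift_ε]
  exact (pushComp M b c _ rfl).hom_inv_id_app_assoc _ _

variable (A) in
/-- The `M`-diagram coinduced by an object of `M(s)`. -/
abbrev coind : MDiagram M where
  obj := coindObj A
  map := coindMap A
  map_id t := coind_hom_ext fun c ↦ by
    rw [← cancel_epi ((pushComp M (𝟙 t) c c (Category.id_comp c)).hom.app (coindObj A t)),
      coindMap_ε, reassoc_of% pushComp_id M c]
  map_comp {t t' t''} b b' := coind_hom_ext fun c ↦ by
    -- Both bracketings of the triple composite are compared with one named morphism `d`, so that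
    -- the associativity coherence applies without transport along an equality.
    obtain ⟨d, hd⟩ : ∃ d, (b ≫ b') ≫ c = d := ⟨_, rfl⟩
    have hd' : b ≫ b' ≫ c = d := by rw [← hd, Category.assoc]
    rw [← cancel_epi ((pushComp M (b ≫ b') c d hd).hom.app (coindObj A t)),
      coindMap_ε (b ≫ b') c d hd, Functor.map_comp, Functor.map_comp, Category.assoc, Category.assoc,
      ← reassoc_of% pushComp_assoc M b b' c (b ≫ b') (b' ≫ c) d rfl rfl hd hd',
      ← reassoc_of% pushComp_naturality M b' c (b' ≫ c) rfl, coindMap_ε, coindMap_ε]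

/-- The component indexed by `𝟙 s` is the universal one: every other component is recovered from it
through the structure maps. Hence a morphism to `coind A` is determined by its value at `s`. -/
lemma coindMap_pushId_inv_ε {t : D} (a : t ⟶ s) :
    coindMap A a ≫ (pushId M s).inv.app (coindObj A s) ≫ coindε A (𝟙 s) = coindε A a := by
  have n : coindMap A a ≫ (pushId M s).inv.app (coindObj A s) =
    (pushId M s).inv.app _ ≫ (push M (𝟙 s)).map (coindMap A a) :=
    (pushId M s).inv.naturality (coindMap A a)
  have h : (pushComp M a (𝟙 s) a (Category.comp_id a)).hom.app (coindObj A t) =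
      (pushId M s).inv.app _ := by
    rw [← cancel_mono ((pushId M s).hom.app _), pushComp_id' M a]
    exact ((pushId M s).inv_hom_id_app _).symm
  rw [reassoc_of% n, ← coindMap_ε a (𝟙 s) a (Category.comp_id a), h]

/-- The coinduced `M`-diagram represents morphisms to an object of `M(s)`. -/
def coindEquiv (X : MDiagram M) (A : Fiber M s) : (X.obj s ⟶ A) ≃ (X ⟶ coind A) where
  toFun φ :=
    { app := fun t ↦ coindLift fun a ↦ X.map a ≫ φ
      naturality := fun {t t'} b ↦ coind_hom_ext fun c ↦ by
        rw [Functor.map_comp, Functor.map_comp, Category.assoc, Category.assoc, coindLift_ε,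
          ← cancel_epi ((pushComp M b c _ rfl).hom.app (X.obj t)),
          ← reassoc_of% pushComp_naturality M b c _ rfl]
        rw [coindMap_ε, coindLift_ε, reassoc_of% X.map_comp' b c _ rfl] }
  invFun ψ := Hom.app ψ s ≫ (pushId M s).inv.app (coindObj A s) ≫ coindε A (𝟙 s)
  left_inv φ := by
    have n : (coindLift fun a : s ⟶ s ↦ X.map a ≫ φ) ≫ (pushId M s).inv.app (coindObj A s) =
      (pushId M s).inv.app (X.obj s) ≫ (push M (𝟙 s)).map (coindLift fun a ↦ X.map a ≫ φ) :=
      (pushId M s).inv.naturality _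
    dsimp only
    rw [reassoc_of% n, coindLift_ε, X.map_id]
    exact (pushId M s).inv_hom_id_app_assoc _ _
  right_inv ψ := hom_ext fun t ↦ coind_hom_ext fun a ↦ by
    dsimp only
    rw [coindLift_ε, ← reassoc_of% Hom.naturality ψ a, coindMap_pushId_inv_ε]

lemma coindEquiv_naturality {X' X : MDiagram M} (A : Fiber M s) (f : X' ⟶ X) (φ : X.obj s ⟶ A) :
    coindEquiv X' A (Hom.app f s ≫ φ) = f ≫ coindEquiv X A φ := by
  refine hom_ext fun t ↦ coind_hom_ext fun a ↦ ?_
  rw [comp_app, Functor.map_comp, Category.assoc]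
  dsimp only [coindEquiv, Equiv.coe_fn_mk]
  rw [coindLift_ε, coindLift_ε, reassoc_of% Hom.naturality f a]

variable (M s) in
/-- Coinduction, as a functor. -/
abbrev coindFunctor : Fiber M s ⥤ MDiagram M :=
  Adjunction.rightAdjointOfEquiv (F := evaluation M s) coindEquiv
    (fun _ _ A f φ ↦ coindEquiv_naturality A f φ)

variable (M s) in
/-- Coinduction is right adjoint to evaluation. -/
def evaluationAdjunction : evaluation M s ⊣ coindFunctor M s :=
  Adjunction.adjunctionOfEquivRight _ _

/-- Coinduction acts at `t` by products of the maps `a^* p`, so levelwise it inherits every lifting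
property shared by these maps. -/
lemma coindFunctor_map_app {A B : Fiber M s} (p : A ⟶ B) (t : D) :
    Hom.app ((coindFunctor M s).map p) t =
      Limits.Pi.map (f := fun a : t ⟶ s ↦ (pull M a).obj A) fun a ↦ (pull M a).map p := by
  refine coind_hom_ext fun a ↦ ?_
  have n := (adj M a).counit.naturality p
  dsimp only [Functor.comp_map, Functor.comp_obj, Functor.id_map, Functor.id_obj] at n
  have h : (push M a).map (Hom.app ((coindFunctor M s).map p) t) ≫ coindε B a =
      coindMap A a ≫ (𝟙 (coindObj A s) ≫ (pushId M s).inv.app (coindObj A s) ≫ coindε A (𝟙 s)) ≫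
        p := coindLift_ε _ a
  rw [h, Category.id_comp, Category.assoc, reassoc_of% coindMap_pushId_inv_ε, coindε, coindε,
    ← Functor.map_comp_assoc, Limits.Pi.map_π, Functor.map_comp, Category.assoc, Category.assoc, n]

end Coinduced

section Induced

variable [∀ (s t : D) (a : s ⟶ t), (push M a).IsLeftAdjoint]
  [∀ s : D, HasColimitsOfSize.{w, w} (Fiber M s)] {s : D} (A : Fiber M s)

/-- The object at `t` of the `M`-diagram induced by an object of `M(s)`. -/
abbrev indObj (t : D) : Fiber M t := ∐ fun a : s ⟶ t ↦ (push M a).obj A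

/-- The universal maps to the objects of the induced `M`-diagram. -/
abbrev indι {t : D} (a : s ⟶ t) : (push M a).obj A ⟶ indObj A t :=
  Sigma.ι (fun a : s ⟶ t ↦ (push M a).obj A) a

variable {A}

/-- Being a left adjoint, `b_*` preserves the coproduct; joint epimorphy is checked after
transposing along the adjunction. -/
lemma push_ind_hom_ext {t t' : D} (b : t ⟶ t') {W : Fiber M t'}
    {f g : (push M b).obj (indObj A t) ⟶ W}
    (h : ∀ a : s ⟶ t, (push M b).map (indι A a) ≫ f = (push M b).map (indι A a) ≫ g) : f = g :=
  ((adj M b).homEquiv _ _).injective (Sigma.hom_ext _ _ fun a ↦ by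
    rw [← (adj M b).homEquiv_naturality_left, ← (adj M b).homEquiv_naturality_left, h])

/-- The morphism out of `b_*` of an object of the induced `M`-diagram given by a family. -/
def pushIndDesc {t t' : D} (b : t ⟶ t') {W : Fiber M t'}
    (φ : ∀ a : s ⟶ t, (push M b).obj ((push M a).obj A) ⟶ W) :
    (push M b).obj (indObj A t) ⟶ W :=
  ((adj M b).homEquiv _ _).symm (Sigma.desc fun a ↦ (adj M b).homEquiv _ _ (φ a))

lemma pushIndDesc_ι {t t' : D} (b : t ⟶ t') {W : Fiber M t'}
    (φ : ∀ a : s ⟶ t, (push M b).obj ((push M a).obj A) ⟶ W) (a : s ⟶ t) :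
    (push M b).map (indι A a) ≫ pushIndDesc b φ = φ a := by
  rw [pushIndDesc, ← (adj M b).homEquiv_naturality_left_symm, Sigma.ι_desc,
    Equiv.symm_apply_apply]

variable (A) in
/-- The structure maps of the induced `M`-diagram. -/
def indMap {t t' : D} (b : t ⟶ t') : (push M b).obj (indObj A t) ⟶ indObj A t' :=
  pushIndDesc b fun a ↦ (pushComp M a b (a ≫ b) rfl).inv.app A ≫ indι A (a ≫ b)

lemma indMap_ι {t t' : D} (a : s ⟶ t) (b : t ⟶ t') (c : s ⟶ t') (h : a ≫ b = c) :
    (pushComp M a b c h).hom.app A ≫ (push M b).map (indι A a) ≫ indMap A b = indι A c := by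
  subst h
  rw [indMap, pushIndDesc_ι]
  exact (pushComp M a b _ rfl).hom_inv_id_app_assoc _ _

variable (A) in
/-- The `M`-diagram induced by an object of `M(s)`. -/
abbrev ind : MDiagram M where
  obj := indObj A
  map := indMap A
  map_id t := push_ind_hom_ext (𝟙 t) fun a ↦ by
    have n : (push M (𝟙 t)).map (indι A a) ≫ (pushId M t).hom.app (indObj A t) =
      (pushId M t).hom.app _ ≫ indι A a := (pushId M t).hom.naturality (indι A a)
    rw [← cancel_epi ((pushComp M a (𝟙 t) a (Category.comp_id a)).hom.app A), indMap_ι, n,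
      reassoc_of% pushComp_id' M a]
  map_comp {t t' t''} b b' := push_ind_hom_ext (b ≫ b') fun a ↦ by
    obtain ⟨d, hd⟩ : ∃ d, a ≫ b ≫ b' = d := ⟨_, rfl⟩
    have hd' : (a ≫ b) ≫ b' = d := by rw [← hd, Category.assoc]
    rw [← cancel_epi ((pushComp M a (b ≫ b') d hd).hom.app A), indMap_ι a (b ≫ b') d hd,
      reassoc_of% pushComp_naturality M b b' (b ≫ b') rfl,
      reassoc_of% pushComp_assoc M a b b' (a ≫ b) (b ≫ b') d rfl rfl hd' hd,
      ← Functor.map_comp_assoc, ← Functor.map_comp_assoc, Category.assoc, indMap_ι, indMap_ι]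

/-- Dually to coinduction, the summand indexed by `𝟙 s` generates all the others through the
structure maps. -/
lemma pushId_inv_map_indι {t : D} (a : s ⟶ t) :
    (push M a).map ((pushId M s).inv.app A ≫ indι A (𝟙 s)) ≫ indMap A a = indι A a := by
  have h : (pushComp M (𝟙 s) a a (Category.id_comp a)).hom.app A =
      (push M a).map ((pushId M s).inv.app A) := by
    rw [← cancel_mono ((push M a).map ((pushId M s).hom.app A)), pushComp_id M a,
      ← Functor.map_comp]
    refine ((push M a).map_id _).symm.trans (congrArg (push M a).map ?_)
    exact ((pushId M s).inv_hom_id_app A).symm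
  rw [Functor.map_comp, Category.assoc, ← h, indMap_ι]

/-- The induced `M`-diagram corepresents morphisms from an object of `M(s)`. -/
def indEquiv (A : Fiber M s) (X : MDiagram M) : (ind A ⟶ X) ≃ (A ⟶ X.obj s) where
  toFun ψ := ((pushId M s).inv.app A ≫ indι A (𝟙 s)) ≫ Hom.app ψ s
  invFun φ :=
    { app := fun t ↦ Sigma.desc fun a ↦ (push M a).map φ ≫ X.map a
      naturality := fun {t t'} b ↦ push_ind_hom_ext b fun a ↦ by
        rw [← Functor.map_comp_assoc, Sigma.ι_desc,
          ← cancel_epi ((pushComp M a b _ rfl).hom.app A), Functor.map_comp, Category.assoc,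
          ← reassoc_of% pushComp_naturality M a b _ rfl φ, X.map_comp' a b _ rfl,
          reassoc_of% indMap_ι a b _ rfl, Sigma.ι_desc] }
  left_inv ψ := hom_ext fun t ↦ Sigma.hom_ext _ _ fun a ↦ by
    dsimp only
    rw [Sigma.ι_desc, Functor.map_comp, Category.assoc, Hom.naturality ψ a]
    exact (reassoc_of% (pushId_inv_map_indι (A := A) a)) _
  right_inv φ := by
    have n : (pushId M s).inv.app A ≫ (push M (𝟙 s)).map φ = φ ≫ (pushId M s).inv.app (X.obj s) :=
      ((pushId M s).inv.naturality φ).symm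
    dsimp only
    rw [Category.assoc, Sigma.ι_desc, reassoc_of% n, X.map_id]
    exact (congrArg (φ ≫ ·) ((pushId M s).inv_hom_id_app _)).trans (Category.comp_id φ)

variable (M s) in
/-- Induction, as a functor. -/
abbrev indFunctor : Fiber M s ⥤ MDiagram M :=
  Adjunction.leftAdjointOfEquiv (G := evaluation M s) indEquiv
    (fun _ _ _ _ _ ↦ (Category.assoc _ _ _).symm)

variable (M s) in
/-- Induction is left adjoint to evaluation. -/
def indAdjunction : indFunctor M s ⊣ evaluation M s :=
  Adjunction.adjunctionOfEquivLeft _ _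

lemma indFunctor_map_app {A B : Fiber M s} (p : A ⟶ B) (t : D) :
    Hom.app ((indFunctor M s).map p) t =
      Limits.Sigma.map (f := fun a : s ⟶ t ↦ (push M a).obj A) fun a ↦ (push M a).map p := by
  refine Sigma.hom_ext _ _ fun a ↦ ?_
  have h : indι A a ≫ Hom.app ((indFunctor M s).map p) t = (push M a).map (p ≫
      ((pushId M s).inv.app B ≫ indι B (𝟙 s)) ≫ 𝟙 _) ≫ indMap B a := Sigma.ι_desc _ _
  rw [Sigma.ι_map]
  refine h.trans ?_
  rw [Category.comp_id, Functor.map_comp, Category.assoc, pushId_inv_map_indι]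

end Induced

end MDiagram

end ModelDiagram

/-! ### Levelwise limits, and levelwise colimits using that each `a_*` is a left adjoint. -/

namespace ModelDiagram

namespace MDiagram

variable {D : Type w} [SmallCategory D] {M : Pseudofunctor (LocallyDiscrete D) Cat.{v, u}}
  {J : Type w} [SmallCategory J] (F : J ⥤ MDiagram M)

/-! ## Limits of `M`-diagrams -/

section Limits

variable [∀ s : D, HasLimitsOfSize.{w, w} (Fiber M s)]

/-- The value at `s` of the limit of a diagram of `M`-diagrams. -/
abbrev limitObj (s : D) : Fiber M s := limit (F ⋙ evaluation M s)

/-- The projections from the values of the limit. -/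
abbrev limitπ (s : D) (j : J) : limitObj F s ⟶ (F.obj j).obj s := limit.π (F ⋙ evaluation M s) j

variable {F} in
lemma limitObj_hom_ext {s : D} {W : Fiber M s} {f g : W ⟶ limitObj F s}
    (h : ∀ j, f ≫ limitπ F s j = g ≫ limitπ F s j) : f = g :=
  limit.hom_ext h

lemma limitπ_w (s : D) {j k : J} (φ : j ⟶ k) :
    limitπ F s j ≫ Hom.app (F.map φ) s = limitπ F s k :=
  limit.w (F ⋙ evaluation M s) φ

/-- The morphism into a value of the limit given by a compatible family. -/
def limitLift {s : D} {W : Fiber M s} (p : ∀ j, W ⟶ (F.obj j).obj s)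
    (hp : ∀ ⦃j k : J⦄ (φ : j ⟶ k), p j ≫ Hom.app (F.map φ) s = p k) : W ⟶ limitObj F s :=
  limit.lift (F ⋙ evaluation M s)
    { pt := W
      π := { app := p
             naturality := fun _ _ φ ↦ (Category.id_comp _).trans (hp φ).symm } }

lemma limitLift_π {s : D} {W : Fiber M s} (p : ∀ j, W ⟶ (F.obj j).obj s)
    (hp : ∀ ⦃j k : J⦄ (φ : j ⟶ k), p j ≫ Hom.app (F.map φ) s = p k) (j : J) :
    limitLift F p hp ≫ limitπ F s j = p j :=
  limit.lift_π _ _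

/-- The structure maps of the limit. -/
def limitMap {s t : D} (a : s ⟶ t) : (push M a).obj (limitObj F s) ⟶ limitObj F t :=
  limitLift F (fun j ↦ (push M a).map (limitπ F s j) ≫ (F.obj j).map a) fun j k φ ↦ by
    rw [Category.assoc, ← Hom.naturality, ← Functor.map_comp_assoc, limitπ_w]

lemma limitMap_π {s t : D} (a : s ⟶ t) (j : J) :
    limitMap F a ≫ limitπ F t j = (push M a).map (limitπ F s j) ≫ (F.obj j).map a :=
  limitLift_π _ _ _ _

/-- The levelwise limit of a diagram of `M`-diagrams. -/
abbrev limitDiagram : MDiagram M where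
  obj := limitObj F
  map := limitMap F
  map_id s := limitObj_hom_ext fun j ↦ by
    rw [limitMap_π, (F.obj j).map_id]
    exact (pushId M s).hom.naturality (limitπ F s j)
  map_comp a b := limitObj_hom_ext fun j ↦ by
    rw [limitMap_π, (F.obj j).map_comp, reassoc_of% pushComp_naturality M a b _ rfl,
      Category.assoc, Category.assoc, limitMap_π, ← Functor.map_comp_assoc,
      ← Functor.map_comp_assoc, limitMap_π]

/-- The levelwise limit cone. -/
abbrev limitDiagramCone : Cone F where
  pt := limitDiagram F
  π :=
    { app := fun j ↦
        { app := fun s ↦ limitπ F s j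
          naturality := fun a ↦ (limitMap_π F a j).symm }
      naturality := fun _ _ φ ↦ hom_ext fun s ↦
        (Category.id_comp _).trans (limitπ_w F s φ).symm }

variable {F} in
/-- The morphism from a cone to the levelwise limit cone. -/
def limitDiagramLift (c : Cone F) : c.pt ⟶ limitDiagram F where
  app s := limitLift F (fun j ↦ Hom.app (c.π.app j) s) fun _ _ φ ↦
    congrArg (fun f ↦ Hom.app f s) (c.w φ)
  naturality {s t} a := limitObj_hom_ext fun j ↦ by
    rw [Category.assoc, Category.assoc, limitMap_π, limitLift_π, ← Functor.map_comp_assoc,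
      limitLift_π]
    exact Hom.naturality (c.π.app j) a

variable {F} in
lemma limitDiagramLift_π (c : Cone F) (s : D) (j : J) :
    Hom.app (limitDiagramLift c) s ≫ limitπ F s j = Hom.app (c.π.app j) s :=
  limitLift_π F _ (fun _ _ φ ↦ congrArg (fun f ↦ Hom.app f s) (c.w φ)) j

/-- The levelwise limit cone is a limit cone. -/
def isLimitLimitDiagramCone : IsLimit (limitDiagramCone F) where
  lift := limitDiagramLift
  fac c j := hom_ext fun s ↦ limitDiagramLift_π c s j
  uniq c _ hm := hom_ext fun s ↦ limitObj_hom_ext fun j ↦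
    (congrArg (fun f ↦ Hom.app f s) (hm j)).trans (limitDiagramLift_π c s j).symm

instance hasLimitsOfSize : HasLimitsOfSize.{w, w} (MDiagram M) where
  has_limits_of_shape _ _ := ⟨fun F ↦ ⟨⟨⟨_, isLimitLimitDiagramCone F⟩⟩⟩⟩

end Limits

/-! ## Colimits of `M`-diagrams -/

section Colimits

variable [∀ s : D, HasColimitsOfSize.{w, w} (Fiber M s)]

/-- The value at `s` of the colimit of a diagram of `M`-diagrams. -/
abbrev colimitObj (s : D) : Fiber M s := colimit (F ⋙ evaluation M s)

/-- The inclusions into the values of the colimit. -/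
abbrev colimitι (s : D) (j : J) : (F.obj j).obj s ⟶ colimitObj F s :=
  colimit.ι (F ⋙ evaluation M s) j

variable {F} in
lemma colimitObj_hom_ext {s : D} {W : Fiber M s} {f g : colimitObj F s ⟶ W}
    (h : ∀ j, colimitι F s j ≫ f = colimitι F s j ≫ g) : f = g :=
  colimit.hom_ext h

lemma colimitι_w (s : D) {j k : J} (φ : j ⟶ k) :
    Hom.app (F.map φ) s ≫ colimitι F s k = colimitι F s j :=
  colimit.w (F ⋙ evaluation M s) φ

/-- The morphism out of a value of the colimit given by a compatible family. -/
def colimitDesc {s : D} {W : Fiber M s} (p : ∀ j, (F.obj j).obj s ⟶ W)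
    (hp : ∀ ⦃j k : J⦄ (φ : j ⟶ k), Hom.app (F.map φ) s ≫ p k = p j) : colimitObj F s ⟶ W :=
  colimit.desc (F ⋙ evaluation M s)
    { pt := W
      ι := { app := p
             naturality := fun _ _ φ ↦ (hp φ).trans (Category.comp_id _).symm } }

lemma colimitι_desc {s : D} {W : Fiber M s} (p : ∀ j, (F.obj j).obj s ⟶ W)
    (hp : ∀ ⦃j k : J⦄ (φ : j ⟶ k), Hom.app (F.map φ) s ≫ p k = p j) (j : J) :
    colimitι F s j ≫ colimitDesc F p hp = p j :=
  colimit.ι_desc _ _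

variable [∀ (s t : D) (a : s ⟶ t), (push M a).IsLeftAdjoint]

variable {F} in
lemma push_colimitObj_hom_ext {s t : D} (a : s ⟶ t) {W : Fiber M t}
    {f g : (push M a).obj (colimitObj F s) ⟶ W}
    (h : ∀ j, (push M a).map (colimitι F s j) ≫ f = (push M a).map (colimitι F s j) ≫ g) :
    f = g :=
  ((adj M a).homEquiv _ _).injective (colimitObj_hom_ext fun j ↦ by
    rw [← (adj M a).homEquiv_naturality_left, ← (adj M a).homEquiv_naturality_left, h])

/-- The structure maps of the colimit. -/
def colimitMap {s t : D} (a : s ⟶ t) : (push M a).obj (colimitObj F s) ⟶ colimitObj F t :=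
  ((adj M a).homEquiv _ _).symm
    (colimitDesc F (fun j ↦ (adj M a).homEquiv _ _ ((F.obj j).map a ≫ colimitι F t j))
      fun j k φ ↦ by
        rw [← (adj M a).homEquiv_naturality_left, reassoc_of% Hom.naturality (F.map φ) a,
          colimitι_w])

lemma colimitι_map {s t : D} (a : s ⟶ t) (j : J) :
    (push M a).map (colimitι F s j) ≫ colimitMap F a = (F.obj j).map a ≫ colimitι F t j := by
  rw [colimitMap, ← (adj M a).homEquiv_naturality_left_symm, colimitι_desc,
    Equiv.symm_apply_apply]

/-- The levelwise colimit of a diagram of `M`-diagrams. -/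
abbrev colimitDiagram : MDiagram M where
  obj := colimitObj F
  map := colimitMap F
  map_id s := push_colimitObj_hom_ext (𝟙 s) fun j ↦ by
    rw [colimitι_map, (F.obj j).map_id]
    exact ((pushId M s).hom.naturality (colimitι F s j)).symm
  map_comp a b := push_colimitObj_hom_ext (a ≫ b) fun j ↦ by
    rw [colimitι_map, (F.obj j).map_comp, reassoc_of% pushComp_naturality M a b _ rfl,
      Category.assoc, Category.assoc, ← Functor.map_comp_assoc, colimitι_map,
      Functor.map_comp_assoc, colimitι_map]

/-- The levelwise colimit cocone. -/
abbrev colimitDiagramCocone : Cocone F where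
  pt := colimitDiagram F
  ι :=
    { app := fun j ↦
        { app := fun s ↦ colimitι F s j
          naturality := fun a ↦ colimitι_map F a j }
      naturality := fun _ _ φ ↦ hom_ext fun s ↦
        (colimitι_w F s φ).trans (Category.comp_id _).symm }

variable {F} in
/-- The morphism from the levelwise colimit cocone to a cocone. -/
def colimitDiagramDesc (c : Cocone F) : colimitDiagram F ⟶ c.pt where
  app s := colimitDesc F (fun j ↦ Hom.app (c.ι.app j) s) fun _ _ φ ↦
    congrArg (fun f ↦ Hom.app f s) (c.w φ)
  naturality {s t} a := push_colimitObj_hom_ext a fun j ↦ by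
    rw [← Functor.map_comp_assoc, colimitι_desc, reassoc_of% colimitι_map F a j, colimitι_desc]
    exact Hom.naturality (c.ι.app j) a

variable {F} in
lemma colimitDiagramDesc_ι (c : Cocone F) (s : D) (j : J) :
    colimitι F s j ≫ Hom.app (colimitDiagramDesc c) s = Hom.app (c.ι.app j) s :=
  colimitι_desc F _ (fun _ _ φ ↦ congrArg (fun f ↦ Hom.app f s) (c.w φ)) j

/-- The levelwise colimit cocone is a colimit cocone. -/
def isColimitColimitDiagramCocone : IsColimit (colimitDiagramCocone F) where
  desc := colimitDiagramDesc
  fac c j := hom_ext fun s ↦ colimitDiagramDesc_ι c s j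
  uniq c _ hm := hom_ext fun s ↦ colimitObj_hom_ext fun j ↦
    (congrArg (fun f ↦ Hom.app f s) (hm j)).trans (colimitDiagramDesc_ι c s j).symm

instance hasColimitsOfSize : HasColimitsOfSize.{w, w} (MDiagram M) where
  has_colimits_of_shape _ _ := ⟨fun F ↦ ⟨⟨⟨_, isColimitColimitDiagramCocone F⟩⟩⟩⟩

end Colimits

end MDiagram

end ModelDiagram

/-! ### Functorial factorizations under equivalences and opposites. -/

namespace CategoryTheory.MorphismProperty

variable {𝒜 : Type*} [Category* 𝒜] {ℬ : Type*} [Category* ℬ]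

namespace FunctorialFactorizationData

lemma comp_inv_comp_hom_comp {X Y Z W : 𝒜} (e : Y ≅ Z) (p : X ⟶ Z) (q : Z ⟶ W) :
    (p ≫ e.inv) ≫ e.hom ≫ q = p ≫ q := by
  rw [Category.assoc, Iso.inv_hom_id_assoc]

/-- The image under a functor of a morphism of arrows. -/
abbrev arrowMap (F : 𝒜 ⥤ ℬ) {f g : CategoryTheory.Arrow 𝒜} (φ : f ⟶ g) :
    CategoryTheory.Arrow.mk (F.map f.hom) ⟶ CategoryTheory.Arrow.mk (F.map g.hom) :=
  F.mapArrow.map φ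

/-- Functorial factorizations are transported along equivalences. -/
def inverseImage (F : 𝒜 ⥤ ℬ) [F.IsEquivalence] {W₁ W₂ : MorphismProperty ℬ}
    [W₁.RespectsIso] [W₂.RespectsIso] (h : FunctorialFactorizationData W₁ W₂) :
    FunctorialFactorizationData (W₁.inverseImage F) (W₂.inverseImage F) where
  Z :=
    { obj := fun f ↦ F.objPreimage (h.factorizationData (F.map f.hom)).Z
      map := fun {f g} φ ↦ F.preimage ((F.objObjPreimageIso _).hom ≫
        h.mapZ (arrowMap F φ) ≫ (F.objObjPreimageIso _).inv)
      map_id := fun f ↦ F.map_injective (by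
        have e : h.mapZ (arrowMap F (𝟙 f)) = 𝟙 (h.factorizationData (F.map f.hom)).Z :=
          (congrArg h.mapZ (F.mapArrow.map_id f)).trans (h.mapZ_id _)
        rw [F.map_preimage, e, Category.id_comp, Iso.hom_inv_id, CategoryTheory.Functor.map_id])
      map_comp := fun {a b c} φ ψ ↦ F.map_injective (by
        have e : h.mapZ (arrowMap F (φ ≫ ψ)) =
            h.mapZ (arrowMap F φ) ≫ h.mapZ (arrowMap F ψ) :=
          (congrArg h.mapZ (F.mapArrow.map_comp φ ψ)).trans (h.mapZ_comp _ _)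
        rw [F.map_preimage, e, F.map_comp, F.map_preimage, F.map_preimage]
        simp only [Category.assoc, Iso.inv_hom_id_assoc]) }
  i :=
    { app := fun f ↦ F.preimage
        ((h.factorizationData (F.map f.hom)).i ≫ (F.objObjPreimageIso _).inv)
      naturality := fun f g φ ↦ F.map_injective (by
        have e : (h.factorizationData (F.map f.hom)).i ≫ h.mapZ (arrowMap F φ) =
          F.map φ.left ≫ (h.factorizationData (F.map g.hom)).i := h.i_mapZ _
        rw [F.map_comp, F.map_comp, F.map_preimage, F.map_preimage, F.map_preimage]
        exact (Category.assoc _ _ _).symm.trans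
          ((congrArg (· ≫ (F.objObjPreimageIso _).inv) e.symm).trans
            ((Category.assoc _ _ _).trans (comp_inv_comp_hom_comp _ _ _).symm))) }
  p :=
    { app := fun f ↦ F.preimage
        ((F.objObjPreimageIso _).hom ≫ (h.factorizationData (F.map f.hom)).p)
      naturality := fun f g φ ↦ F.map_injective (by
        have e : h.mapZ (arrowMap F φ) ≫ (h.factorizationData (F.map g.hom)).p =
          (h.factorizationData (F.map f.hom)).p ≫ F.map φ.right := h.mapZ_p _
        rw [F.map_comp, F.map_comp, F.map_preimage, F.map_preimage, F.map_preimage]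
        exact (congrArg (· ≫ (F.objObjPreimageIso _).hom ≫ _) (Category.assoc _ _ _).symm).trans
          ((comp_inv_comp_hom_comp _ _ _).trans ((Category.assoc _ _ _).trans
            ((congrArg ((F.objObjPreimageIso _).hom ≫ ·) e).trans (Category.assoc _ _ _).symm)))) }
  fac := NatTrans.ext (funext fun f ↦ F.map_injective (by
    have e : F.map (F.preimage ((h.factorizationData (F.map f.hom)).i ≫
        (F.objObjPreimageIso _).inv) ≫ F.preimage ((F.objObjPreimageIso _).hom ≫
        (h.factorizationData (F.map f.hom)).p)) = F.map f.hom := by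
      rw [F.map_comp, F.map_preimage, F.map_preimage, comp_inv_comp_hom_comp,
        (h.factorizationData (F.map f.hom)).fac]
    exact e))
  hi f := by
    refine (W₁.arrow_mk_iso_iff (f := (h.factorizationData (F.map f.hom)).i) ?_).1
      (h.factorizationData (F.map f.hom)).hi
    refine CategoryTheory.Arrow.isoMk (Iso.refl _) (F.objObjPreimageIso _).symm ?_
    refine (Category.id_comp _).trans (F.map_preimage _)
  hp f := by
    refine (W₂.arrow_mk_iso_iff (f := (h.factorizationData (F.map f.hom)).p) ?_).1
      (h.factorizationData (F.map f.hom)).hp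
    refine CategoryTheory.Arrow.isoMk (F.objObjPreimageIso _).symm (Iso.refl _) ?_
    refine Eq.trans ?_ (Category.comp_id _).symm
    refine (congrArg ((F.objObjPreimageIso _).inv ≫ ·) (F.map_preimage _)).trans ?_
    exact Iso.inv_hom_id_assoc _ _

/-- The morphism of arrows opposite to a morphism of arrows of the opposite category. -/
abbrev arrowUnop {f g : CategoryTheory.Arrow 𝒜ᵒᵖ} (φ : f ⟶ g) :
    CategoryTheory.Arrow.mk g.hom.unop ⟶ CategoryTheory.Arrow.mk f.hom.unop :=
  CategoryTheory.Arrow.homMk φ.right.unop φ.left.unop (congrArg Quiver.Hom.unop φ.w.symm)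

/-- Functorial factorizations in a category induce functorial factorizations in its opposite. -/
def op {W₁ W₂ : MorphismProperty 𝒜} (h : FunctorialFactorizationData W₁ W₂) :
    FunctorialFactorizationData W₂.op W₁.op where
  Z :=
    { obj := fun f ↦ Opposite.op (h.factorizationData f.hom.unop).Z
      map := fun φ ↦ (h.mapZ (arrowUnop φ)).op
      map_id := fun f ↦ congrArg Quiver.Hom.op (h.mapZ_id f.hom.unop)
      map_comp := fun φ ψ ↦ congrArg Quiver.Hom.op (h.mapZ_comp (arrowUnop ψ) (arrowUnop φ)) }
  i :=
    { app := fun f ↦ (h.factorizationData f.hom.unop).p.op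
      naturality := fun _ _ φ ↦ congrArg Quiver.Hom.op (h.mapZ_p (arrowUnop φ)).symm }
  p :=
    { app := fun f ↦ (h.factorizationData f.hom.unop).i.op
      naturality := fun _ _ φ ↦ congrArg Quiver.Hom.op (h.i_mapZ (arrowUnop φ)) }
  fac := by
    ext f
    exact congrArg Quiver.Hom.op (h.factorizationData f.hom.unop).fac
  hi f := (h.factorizationData f.hom.unop).hp
  hp f := (h.factorizationData f.hom.unop).hi

end FunctorialFactorizationData

lemma HasFunctorialFactorization.inverseImage (F : 𝒜 ⥤ ℬ) [F.IsEquivalence]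
    (W₁ W₂ : MorphismProperty ℬ) [W₁.RespectsIso] [W₂.RespectsIso]
    [HasFunctorialFactorization W₁ W₂] :
    HasFunctorialFactorization (W₁.inverseImage F) (W₂.inverseImage F) :=
  ⟨⟨(functorialFactorizationData W₁ W₂).inverseImage F⟩⟩

instance HasFunctorialFactorization.op (W₁ W₂ : MorphismProperty 𝒜)
    [HasFunctorialFactorization W₁ W₂] : HasFunctorialFactorization W₂.op W₁.op :=
  ⟨⟨(functorialFactorizationData W₁ W₂).op⟩⟩

/-- Passing to opposites once more gives factorizations in the double opposite, which are pulled
back along its equivalence with `𝒜`. -/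
lemma HasFunctorialFactorization.of_op {W₁ W₂ : MorphismProperty 𝒜}
    [W₁.RespectsIso] [W₂.RespectsIso] [HasFunctorialFactorization W₂.op W₁.op] :
    HasFunctorialFactorization W₁ W₂ :=
  HasFunctorialFactorization.inverseImage (opOp 𝒜) W₁.op.op W₂.op.op

end CategoryTheory.MorphismProperty

/-! ### Model structures from functorial weak factorization systems. -/

namespace HomotopicalAlgebra.ModelCategory

open MorphismProperty

variable {𝒜 : Type*} [Category* 𝒜] [HasFiniteLimits 𝒜] [HasFiniteColimits 𝒜]

/-- A model category structure given by two weak factorization systems. -/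
abbrev ofClasses (Cof Fib W : MorphismProperty 𝒜) [W.HasTwoOutOfThreeProperty]
    [IsWeakFactorizationSystem Cof (Fib ⊓ W)] [IsWeakFactorizationSystem (Cof ⊓ W) Fib] :
    ModelCategory 𝒜 :=
  letI : CategoryWithFibrations 𝒜 := ⟨Fib⟩
  letI : CategoryWithCofibrations 𝒜 := ⟨Cof⟩
  letI : CategoryWithWeakEquivalences 𝒜 := ⟨W⟩
  haveI : (weakEquivalences 𝒜).HasTwoOutOfThreeProperty := ‹W.HasTwoOutOfThreeProperty›
  haveI : IsWeakFactorizationSystem (cofibrations 𝒜) (trivialFibrations 𝒜) :=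
    ‹IsWeakFactorizationSystem Cof (Fib ⊓ W)›
  haveI : IsWeakFactorizationSystem (trivialCofibrations 𝒜) (fibrations 𝒜) :=
    ‹IsWeakFactorizationSystem (Cof ⊓ W) Fib›
  ModelCategory.mk' 𝒜

end HomotopicalAlgebra.ModelCategory

namespace CategoryTheory.MorphismProperty

variable {𝒜 : Type*} [Category* 𝒜]

/-- Weak factorization systems with functorial factorizations. -/
structure IsFunctorialWeakFactorizationSystem (W₁ W₂ : MorphismProperty 𝒜) : Prop where
  retracts_left : W₁.IsStableUnderRetracts
  retracts_right : W₂.IsStableUnderRetracts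
  hasLiftingProperty ⦃A B X Y : 𝒜⦄ (i : A ⟶ B) (p : X ⟶ Y) :
    W₁ i → W₂ p → HasLiftingProperty i p
  hasFunctorialFactorization : HasFunctorialFactorization W₁ W₂

namespace IsFunctorialWeakFactorizationSystem

variable {W₁ W₂ : MorphismProperty 𝒜}

lemma isWeakFactorizationSystem (h : IsFunctorialWeakFactorizationSystem W₁ W₂) :
    IsWeakFactorizationSystem W₁ W₂ := by
  obtain ⟨_, _, hl, _⟩ := h
  exact .mk' _ _ fun i p hi hp ↦ hl i p hi hp

/-- In a weak factorization system each class is defined by lifting against the other, and such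
classes are stable under retracts. -/
lemma of_isWeakFactorizationSystem [IsWeakFactorizationSystem W₁ W₂]
    (h : HasFunctorialFactorization W₁ W₂) : IsFunctorialWeakFactorizationSystem W₁ W₂ where
  retracts_left := by
    rw [← llp_eq_of_wfs W₁ W₂]
    infer_instance
  retracts_right := by
    rw [← rlp_eq_of_wfs W₁ W₂]
    infer_instance
  hasLiftingProperty _ _ _ _ i p hi hp := hasLiftingProperty_of_wfs i p hi hp
  hasFunctorialFactorization := h

lemma op (h : IsFunctorialWeakFactorizationSystem W₁ W₂) :
    IsFunctorialWeakFactorizationSystem W₂.op W₁.op := by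
  obtain ⟨_, _, hl, _⟩ := h
  exact ⟨inferInstance, inferInstance,
    fun _ _ _ _ i p hi hp ↦ (HasLiftingProperty.iff_unop i p).2 (hl _ _ hp hi), inferInstance⟩

lemma of_op (h : IsFunctorialWeakFactorizationSystem W₂.op W₁.op) :
    IsFunctorialWeakFactorizationSystem W₁ W₂ := by
  obtain ⟨_, _, hl, _⟩ := h
  have h₁ : W₁.IsStableUnderRetracts := inferInstanceAs W₁.op.unop.IsStableUnderRetracts
  have h₂ : W₂.IsStableUnderRetracts := inferInstanceAs W₂.op.unop.IsStableUnderRetracts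
  exact ⟨h₁, h₂, fun _ _ _ _ i p hi hp ↦ (HasLiftingProperty.iff_op).2 (hl _ _ hp hi),
    HasFunctorialFactorization.of_op⟩

/-- If the right class `Fib ⊓ W` lifts against `Cof`, the left class `TC` is `Cof ⊓ W`. -/
lemma inf_eq_left {Cof Fib W TC : MorphismProperty 𝒜} [W.HasTwoOutOfThreeProperty]
    (h : IsFunctorialWeakFactorizationSystem TC Fib)
    (h' : IsFunctorialWeakFactorizationSystem Cof (Fib ⊓ W)) (hTC : TC ≤ Cof ⊓ W) :
    Cof ⊓ W = TC := by
  refine le_antisymm (fun X Y f hf ↦ ?_) hTC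
  obtain ⟨_, _, _, _⟩ := h
  have φ := factorizationData TC Fib f
  -- By two-out-of-three the second factor lies in `Fib ⊓ W`, so `f` lifts against it and is a
  -- retract of the first factor.
  have hp : W φ.p := W.of_precomp φ.i φ.p (hTC _ φ.hi).2 (by rw [φ.fac]; exact hf.2)
  have := h'.hasLiftingProperty f φ.p hf.1 ⟨φ.hp, hp⟩
  exact of_retract (RetractArrow.ofLeftLiftingProperty φ.fac) φ.hi

/-- If the left class `Cof ⊓ W` lifts against `Fib`, the right class `TF` is `Fib ⊓ W`. -/
lemma inf_eq_right {Cof Fib W TF : MorphismProperty 𝒜} [W.HasTwoOutOfThreeProperty]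
    (h : IsFunctorialWeakFactorizationSystem Cof TF)
    (h' : IsFunctorialWeakFactorizationSystem (Cof ⊓ W) Fib) (hTF : TF ≤ Fib ⊓ W) :
    Fib ⊓ W = TF := by
  refine le_antisymm (fun X Y f hf ↦ ?_) hTF
  obtain ⟨_, _, _, _⟩ := h
  have φ := factorizationData Cof TF f
  -- By two-out-of-three the first factor lies in `Cof ⊓ W`, so it lifts against `f`, and `f` is a
  -- retract of the second factor.
  have hi : W φ.i := W.of_postcomp φ.i φ.p (hTF _ φ.hp).2 (by rw [φ.fac]; exact hf.2)
  have := h'.hasLiftingProperty φ.i f ⟨φ.hi, hi⟩ hf.1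
  exact of_retract (RetractArrow.ofRightLiftingProperty φ.fac) φ.hp

end IsFunctorialWeakFactorizationSystem

end CategoryTheory.MorphismProperty

/-! ### Weak factorization systems on `M`-diagrams. -/

namespace ModelDiagram

open MorphismProperty

namespace HetSystem

variable {I : Type*} {E : I → I → Type*} {T : ∀ {q r s : I}, E q r → E r s → E q s → Prop}
  {C : I → Type*} [∀ i, Category* (C i)] {H : HetSystem E T C}
  {𝒜 : Type*} [Category* 𝒜] (F : 𝒜 ⥤ H.Diagram) [F.IsEquivalence]
  (L : ∀ {X Y : 𝒜} (f : X ⟶ Y) (s : I), RelLatching (F.map f) s)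

/-- The weak factorization system in a category of diagrams induced by weak factorization
systems in the categories of values. -/
theorem isFunctorialWeakFactorizationSystem {O : Type*} [Preorder O] [WellFoundedLT O] (d : I → O)
    (hd : ∀ {r s : I}, E r s → d r < d s) {W₁ W₂ : ∀ i, MorphismProperty (C i)}
    (h : ∀ i, IsFunctorialWeakFactorizationSystem (W₁ i) (W₂ i)) :
    IsFunctorialWeakFactorizationSystem (𝒜 := 𝒜) (fun _ _ f ↦ ∀ s, W₁ s (L f s).comparison)
      (fun _ _ f ↦ ∀ s, W₂ s (Diagram.Hom.app (F.map f) s)) := by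
  have := fun i ↦ (h i).retracts_left
  have := fun i ↦ (h i).retracts_right
  have := fun i ↦ (h i).hasFunctorialFactorization
  have hL {X Y : H.Diagram} (f : X ⟶ Y) (s : I) : Nonempty (RelLatching f s) :=
    nonempty_relLatching_of_isEquivalence F (fun f s ↦ ⟨L f s⟩) f s
  have e : (relLatchingProperty (H := H) W₁).inverseImage F =
      fun _ _ f ↦ ∀ s, W₁ s (L f s).comparison := by
    ext X Y f
    exact relLatchingProperty_iff (L f)
  have : (relLatchingProperty (H := H) W₁).IsStableUnderRetracts :=
    ⟨fun r hg s ↦ by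
      obtain ⟨K, hK⟩ := hg s
      obtain ⟨K'⟩ := hL _ s
      exact ⟨K', of_retract (K'.retractArrow K r) hK⟩⟩
  have : (levelwiseProperty (H := H) W₂).IsStableUnderRetracts :=
    ⟨fun r hg s ↦ of_retract (r.map (Diagram.eval H s)) (hg s)⟩
  have := hasFunctorialFactorization_relLatchingProperty (H := H) d hd W₁ W₂ hL
  rw [← e]
  refine ⟨inferInstance,
    inferInstanceAs ((levelwiseProperty (H := H) W₂).inverseImage F).IsStableUnderRetracts,
    fun A B X Y i p hi hp ↦ ?_, 
    HasFunctorialFactorization.inverseImage F (relLatchingProperty W₁) (levelwiseProperty W₂)⟩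
  rw [e] at hi
  have := hasLiftingProperty_of_relLatching d hd (F.map i) (F.map p) (L i)
    fun s ↦ (h s).hasLiftingProperty _ _ (hi s) (hp s)
  -- The lifting problem is solved after applying the equivalence; fullness brings the lift back and
  -- faithfulness the two triangles.
  refine ⟨fun {u v} sq ↦ ?_⟩
  have sq' := sq.map F
  exact ⟨⟨{ l := F.preimage sq'.lift
            fac_left := F.map_injective (by simp)
            fac_right := F.map_injective (by simp) }⟩⟩

end HetSystem

namespace MDiagram

variable {D : Type w} [SmallCategory D] {M : Pseudofunctor (LocallyDiscrete D) Cat.{v, u}}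

/-- The morphisms of `M`-diagrams all of whose components belong to `W`. -/
abbrev levelwise (W : ∀ s, MorphismProperty (Fiber M s)) : MorphismProperty (MDiagram M) :=
  fun _ _ f ↦ ∀ s, W s (Hom.app f s)

instance (W : ∀ s, MorphismProperty (Fiber M s)) [∀ s, (W s).HasTwoOutOfThreeProperty] :
    (levelwise W).HasTwoOutOfThreeProperty where
  comp_mem _ _ hf hg s := (W s).comp_mem _ _ (hf s) (hg s)
  of_postcomp _ _ hg hfg s := (W s).of_postcomp _ _ (hg s) (hfg s)
  of_precomp _ _ hf hfg s := (W s).of_precomp _ _ (hf s) (hfg s)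

section

variable [∀ s : D, HasColimitsOfSize.{w, w} (Fiber M s)] [∀ s : D, HasPushouts (Fiber M s)]

/-- The morphisms of `M`-diagrams all of whose relative latching maps belong to `W`. -/
abbrev latching (W : ∀ s, MorphismProperty (Fiber M s)) : MorphismProperty (MDiagram M) :=
  fun _ _ f ↦ ∀ s, W s (relLatchingMap f s)

theorem isFunctorialWeakFactorizationSystem_latching (hD : IsDirect D)
    {W₁ W₂ : ∀ s, MorphismProperty (Fiber M s)}
    (h : ∀ s, IsFunctorialWeakFactorizationSystem (W₁ s) (W₂ s)) :
    IsFunctorialWeakFactorizationSystem (latching W₁) (levelwise W₂) := by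
  obtain ⟨l, d, hd⟩ := hD.exists_degree
  have := isEquivalence_toDiagram M hD.nonIdComp
  have h' := HetSystem.isFunctorialWeakFactorizationSystem (toDiagram M) relLatching d hd h
  simp only [relLatching_comparison] at h'
  exact h'

end

section

variable [∀ (s t : D) (a : s ⟶ t), (push M a).IsLeftAdjoint]
  [∀ s : D, HasLimitsOfSize.{w, w} (Fiber M s)] [∀ s : D, HasPullbacks (Fiber M s)]

/-- The morphisms of `M`-diagrams all of whose relative matching maps belong to `W`. -/
abbrev matching (W : ∀ s, MorphismProperty (Fiber M s)) : MorphismProperty (MDiagram M) :=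
  fun _ _ f ↦ ∀ s, W s (relMatchingMap f s)

/-- The result for latching maps is applied to the opposite system, with the roles of `W₁` and `W₂`
exchanged; an inverse shape supplies a degree that increases along reversed edges. -/
theorem isFunctorialWeakFactorizationSystem_matching (hD : IsInverse D)
    {W₁ W₂ : ∀ s, MorphismProperty (Fiber M s)}
    (h : ∀ s, IsFunctorialWeakFactorizationSystem (W₁ s) (W₂ s)) :
    IsFunctorialWeakFactorizationSystem (levelwise W₁) (matching W₂) := by
  obtain ⟨l, d, hd⟩ := hD.exists_degree
  have := isEquivalence_toDiagram M hD.nonIdComp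
  have h' := HetSystem.isFunctorialWeakFactorizationSystem (toOpDiagram M)
    (fun f s ↦ relMatching f.unop s) d hd fun s ↦ (h s).op
  simp only [relMatching_comparison] at h'
  exact .of_op h'

end

section

variable [∀ s : D, ModelCategory (Fiber M s)]

section

variable [∀ (s t : D) (a : s ⟶ t), IsLeftQuillen (push M a)]

/-- By adjunction this is lifting of `a_* i`, still a trivial cofibration, against `p`. -/
lemma hasLiftingProperty_pull {s t : D} (a : s ⟶ t) {A B : Fiber M s} {X Y : Fiber M t}
    {i : A ⟶ B} {p : X ⟶ Y} (hi : trivialCofibrations _ i) (hp : fibrations _ p) :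
    HasLiftingProperty i ((pull M a).map p) := by
  rw [← (adj M a).hasLiftingProperty_iff]
  obtain ⟨h, h'⟩ := (mem_trivialCofibrations_iff i).1 hi
  exact hasLiftingProperty_of_wfs _ _ ((mem_trivialCofibrations_iff _).2
    (IsLeftQuillen.trivialCofibration_map i h h')) hp

end

variable [∀ s : D, IsBicompleteFunctorial.{w} (Fiber M s)]

lemma isFunctorialWeakFactorizationSystem_cof (s : D) :
    IsFunctorialWeakFactorizationSystem (cofibrations (Fiber M s))
      (trivialFibrations (Fiber M s)) :=
  .of_isWeakFactorizationSystem (IsBicompleteFunctorial.functorial_cof_trivFib.{w})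

lemma isFunctorialWeakFactorizationSystem_trivCof (s : D) :
    IsFunctorialWeakFactorizationSystem (trivialCofibrations (Fiber M s))
      (fibrations (Fiber M s)) :=
  .of_isWeakFactorizationSystem (IsBicompleteFunctorial.functorial_trivCof_fib.{w})

variable [∀ (s t : D) (a : s ⟶ t), IsLeftQuillen (push M a)]

/-- Fibrations are detected by lifting against trivial cofibrations, and such a lifting property
passes to products. -/
lemma levelwise_coindFunctor_map {s : D} {A B : Fiber M s} {p : A ⟶ B} (hp : fibrations _ p) :
    levelwise (fun s ↦ fibrations (Fiber M s)) ((coindFunctor M s).map p) := by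
  intro t
  rw [coindFunctor_map_app, ← trivialCofibrations_rlp]
  intro X Y i hi
  have := fun a : t ⟶ s ↦ hasLiftingProperty_pull a hi hp
  infer_instance

lemma levelwise_indFunctor_map {s : D} {A B : Fiber M s} {i : A ⟶ B} (hi : cofibrations _ i) :
    levelwise (fun s ↦ cofibrations (Fiber M s)) ((indFunctor M s).map i) := by
  intro t
  rw [indFunctor_map_app, ← trivialFibrations_llp]
  intro X Y p hp
  have := fun a : s ⟶ t ↦ hasLiftingProperty_of_wfs ((push M a).map i) p ((cofibration_iff _).1
    (IsLeftQuillen.cofibration_map i ((cofibration_iff i).2 hi))) hp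
  infer_instance

/-- It suffices to lift the component at `s` against every fibration `p`. By adjunction this means
lifting `f` against the coinduced morphism of `p`, a levelwise fibration, which the weak
factorization system already provides. No analysis of the latching functor is needed. -/
lemma latching_trivialCofibrations_le (hD : IsDirect D) :
    latching (fun s ↦ trivialCofibrations (Fiber M s)) ≤
      levelwise (fun s ↦ trivialCofibrations (Fiber M s)) := by
  intro X Y f hf s
  rw [← fibrations_llp]
  intro A B p hp
  exact ((evaluationAdjunction M s).hasLiftingProperty_iff f p).2
    ((isFunctorialWeakFactorizationSystem_latching hD
      isFunctorialWeakFactorizationSystem_trivCof).hasLiftingProperty _ _ hf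
        (levelwise_coindFunctor_map hp))

/-- Dually, lifting a cofibration `i` against the component at `s` amounts to lifting the morphism
induced by `i`, a levelwise cofibration, against `f`. -/
lemma matching_trivialFibrations_le (hD : IsInverse D) :
    matching (fun s ↦ trivialFibrations (Fiber M s)) ≤
      levelwise (fun s ↦ trivialFibrations (Fiber M s)) := by
  intro X Y f hf s
  rw [← cofibrations_rlp]
  intro A B i hi
  exact ((indAdjunction M s).hasLiftingProperty_iff i f).1
    ((isFunctorialWeakFactorizationSystem_matching hD
      isFunctorialWeakFactorizationSystem_cof).hasLiftingProperty _ _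
        (levelwise_indFunctor_map hi) hf)

end

end MDiagram

end ModelDiagram

/-! ### Assembly of the two model structures. -/

namespace HomotopicalAlgebra.ModelCategory

open MorphismProperty

variable {𝒜 : Type*} [Category* 𝒜]

/-- A model category structure with functorial factorizations on a category with small limits
and colimits is given by two functorial weak factorization systems. -/
theorem exists_of_isFunctorialWeakFactorizationSystem [HasLimitsOfSize.{w, w} 𝒜]
    [HasColimitsOfSize.{w, w} 𝒜] (Cof Fib W : MorphismProperty 𝒜) [W.HasTwoOutOfThreeProperty]
    (h : IsFunctorialWeakFactorizationSystem Cof (Fib ⊓ W))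
    (h' : IsFunctorialWeakFactorizationSystem (Cof ⊓ W) Fib) :
    ∃ _ : ModelCategory 𝒜, ModelDiagram.IsBicompleteFunctorial.{w} 𝒜 ∧
      weakEquivalences 𝒜 = W ∧ fibrations 𝒜 = Fib ∧ cofibrations 𝒜 = Cof := by
  have := h.isWeakFactorizationSystem
  have := h'.isWeakFactorizationSystem
  have := hasFiniteLimits_of_hasLimitsOfSize 𝒜
  have := hasFiniteColimits_of_hasColimitsOfSize 𝒜
  let := ofClasses Cof Fib W
  exact ⟨this, { hasLimits := inferInstance
                 hasColimits := inferInstance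
                 functorial_cof_trivFib := h.hasFunctorialFactorization
                 functorial_trivCof_fib := h'.hasFunctorialFactorization }, rfl, rfl, rfl⟩

end HomotopicalAlgebra.ModelCategory

namespace ModelDiagram.MDiagram

open MorphismProperty

variable {D : Type w} [SmallCategory D] {M : Pseudofunctor (LocallyDiscrete D) Cat.{v, u}}
  [∀ s : D, ModelCategory (Fiber M s)]

lemma levelwise_fibrations_inf :
    levelwise (fun s ↦ fibrations (Fiber M s)) ⊓ levelwise (fun s ↦ weakEquivalences (Fiber M s)) =
      levelwise (fun s ↦ trivialFibrations (Fiber M s)) := by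
  ext X Y f
  exact forall_and.symm

lemma levelwise_cofibrations_inf :
    levelwise (fun s ↦ cofibrations (Fiber M s)) ⊓
        levelwise (fun s ↦ weakEquivalences (Fiber M s)) =
      levelwise (fun s ↦ trivialCofibrations (Fiber M s)) := by
  ext X Y f
  exact forall_and.symm

variable [∀ s : D, IsBicompleteFunctorial.{w} (Fiber M s)]
  [∀ (s t : D) (a : s ⟶ t), IsLeftQuillen (push M a)]

/-- This makes the two weak factorization systems share a single class of weak equivalences. One
inclusion is `latching_trivialCofibrations_le`, the other the retract argument of `inf_eq_left`. -/
lemma latching_cofibrations_inf (hD : IsDirect D) :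
    latching (fun s ↦ cofibrations (Fiber M s)) ⊓ levelwise (fun s ↦ weakEquivalences (Fiber M s)) =
      latching (fun s ↦ trivialCofibrations (Fiber M s)) := by
  refine IsFunctorialWeakFactorizationSystem.inf_eq_left
    (isFunctorialWeakFactorizationSystem_latching hD isFunctorialWeakFactorizationSystem_trivCof) ?_
    fun X Y f hf ↦ ⟨fun s ↦ (hf s).1, fun s ↦ (latching_trivialCofibrations_le hD f hf s).2⟩
  rw [levelwise_fibrations_inf]
  exact isFunctorialWeakFactorizationSystem_latching hD isFunctorialWeakFactorizationSystem_cof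

lemma matching_fibrations_inf (hD : IsInverse D) :
    matching (fun s ↦ fibrations (Fiber M s)) ⊓ levelwise (fun s ↦ weakEquivalences (Fiber M s)) =
      matching (fun s ↦ trivialFibrations (Fiber M s)) := by
  refine IsFunctorialWeakFactorizationSystem.inf_eq_right
    (isFunctorialWeakFactorizationSystem_matching hD isFunctorialWeakFactorizationSystem_cof) ?_
    fun X Y f hf ↦ ⟨fun s ↦ (hf s).1, fun s ↦ (matching_trivialFibrations_le hD f hf s).2⟩
  rw [levelwise_cofibrations_inf]
  exact isFunctorialWeakFactorizationSystem_matching hD isFunctorialWeakFactorizationSystem_trivCof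

end ModelDiagram.MDiagram

end

open ModelDiagram MDiagram in
theorem theorem3p1 {D : Type w} [SmallCategory D]
    (M : Pseudofunctor (LocallyDiscrete D) Cat.{v, u})
    [∀ s : D, ModelCategory (Fiber M s)]
    [∀ s : D, IsBicompleteFunctorial.{w} (Fiber M s)]
    [∀ (s t : D) (a : s ⟶ t), IsLeftQuillen (push M a)] :
    (IsDirect D →
      ∃ _ : ModelCategory (MDiagram M),
        IsBicompleteFunctorial.{w} (MDiagram M) ∧
        ∀ ⦃X Y : MDiagram M⦄ (f : X ⟶ Y),
          (WeakEquivalence f ↔ ∀ s, WeakEquivalence (Hom.app f s)) ∧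
          (Fibration f ↔ ∀ s, Fibration (Hom.app f s)) ∧
          (Cofibration f ↔ ∀ s, Cofibration (relLatchingMap f s)) ∧
          (Cofibration f ∧ WeakEquivalence f ↔
            ∀ s, Cofibration (relLatchingMap f s) ∧ WeakEquivalence (relLatchingMap f s))) ∧
    (IsInverse D →
      ∃ _ : ModelCategory (MDiagram M),
        IsBicompleteFunctorial.{w} (MDiagram M) ∧
        ∀ ⦃X Y : MDiagram M⦄ (f : X ⟶ Y),
          (WeakEquivalence f ↔ ∀ s, WeakEquivalence (Hom.app f s)) ∧
          (Cofibration f ↔ ∀ s, Cofibration (Hom.app f s)) ∧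
          (Fibration f ↔ ∀ s, Fibration (relMatchingMap f s)) ∧
          (Fibration f ∧ WeakEquivalence f ↔
            ∀ s, Fibration (relMatchingMap f s) ∧ WeakEquivalence (relMatchingMap f s))) := by
  refine ⟨fun hD ↦ ?_, fun hD ↦ ?_⟩
  · have h := latching_cofibrations_inf (M := M) hD
    obtain ⟨m, hm, hW, hF, hC⟩ :=
      ModelCategory.exists_of_isFunctorialWeakFactorizationSystem.{w}
        (latching (fun s ↦ cofibrations (Fiber M s))) (levelwise (fun s ↦ fibrations (Fiber M s)))
        (levelwise (fun s ↦ weakEquivalences (Fiber M s)))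
        (by
          rw [levelwise_fibrations_inf]
          exact isFunctorialWeakFactorizationSystem_latching hD
            isFunctorialWeakFactorizationSystem_cof)
        (by
          rw [h]
          exact isFunctorialWeakFactorizationSystem_latching hD
            isFunctorialWeakFactorizationSystem_trivCof)
    refine ⟨m, hm, fun X Y f ↦ ?_⟩
    -- Evaluated at `f`, the equality of classes is the description of trivial cofibrations; the
    -- other descriptions hold by the choice of the classes.
    have hf := congrFun (congrFun (congrFun h X) Y) f
    simp only [weakEquivalence_iff, fibration_iff, cofibration_iff, hW, hF, hC, true_and]
    exact iff_of_eq hf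
  · have h := matching_fibrations_inf (M := M) hD
    obtain ⟨m, hm, hW, hF, hC⟩ :=
      ModelCategory.exists_of_isFunctorialWeakFactorizationSystem.{w}
        (levelwise (fun s ↦ cofibrations (Fiber M s))) (matching (fun s ↦ fibrations (Fiber M s)))
        (levelwise (fun s ↦ weakEquivalences (Fiber M s)))
        (by
          rw [h]
          exact isFunctorialWeakFactorizationSystem_matching hD
            isFunctorialWeakFactorizationSystem_cof)
        (by
          rw [levelwise_cofibrations_inf]
          exact isFunctorialWeakFactorizationSystem_matching hD
            isFunctorialWeakFactorizationSystem_trivCof)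
    refine ⟨m, hm, fun X Y f ↦ ?_⟩
    have hf := congrFun (congrFun (congrFun h X) Y) f
    simp only [weakEquivalence_iff, fibration_iff, cofibration_iff, hW, hF, hC, true_and]
    exact iff_of_eq hf
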